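/- All graphs are finite and simple. A bridge of a connected graph is an edge whose removal disconnects it; a connected graph is biconnected if it has no bridge but the removal of some edge creates one (2-edge-connected, not 3-edge-connected); a bi-bridge of such a graph is a set of two edges whose removal disconnects it. Two edges of a graph $H$ are distinct if no automorphism of $H$ maps one to the other. Construction. Let $G$ be a biconnected cubic graph on $n$ vertices. Choose a bi-bridge $\{a_1b_1,a_2b_2\}$ of $G$ that partitions the vertices as evenly as possible into two parts, and call $G_1$ a part whose induced subgraph contains at least as many pairwise distinct edges on cycles (distinctness and cycles taken in that induced subgraph) as the other one; name the ends so that $b_1,b_2\in G_1$. Delete $a_1b_1,a_2b_2$ and add four vertices $n_1,n_2,n_3,n_4$ and the edges $a_1n_1,\ a_2n_1,\ n_1n_2,\ n_2n_3,\ n_2n_4,\ n_3b_1,\ n_4b_2$. Call the result $G'$, and let $G_1'$ be its subgraph induced on $G_1\cup\{n_2,n_3,n_4\}$. From each $\mathrm{Aut}(G_1')$-class of edges of $G_1'$ that lie on a cycle of $G_1'$ and avoid $n_3,n_4$ choose one edge $xy$ and an order of its ends such that $xn_3$ and $yn_4$ are not edges of $G'$; delete $xy$ from $G'$ and add $xn_3$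 and $yn_4$. So there is one output graph for each class. Theorem 4.3. 1. The construction can be carried out on every biconnected cubic graph $G$ on $n$ vertices. 2. Whatever choices are made, every output is a connected cubic graph on $n+4$ vertices with a bridge. 3. For every $M$ there is an $N$ such that for all $n\ge N$, every biconnected cubic graph $G$ on $n$ vertices and all choices, $G_1'$ has at least $M$ pairwise distinct edges on cycles. 4. For every $M$ there is an $N$ such that for all $n\ge N$ the following holds. Let $(G_i)_{i\in I}$ be pairwise non-isomorphic biconnected cubic graphs on $n$ vertices (for instance one from each isomorphism class), and carry out the construction on each of them, with arbitrary choices. Then one can select exactly $M$ of the outputs of each $G_i$ so that all the selected graphs are pairwise non-isomorphic, both those from the same $G_i$ and those from different ones. -/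

import Mathlib

namespace BridgeConstruction

/-- Every vertex has exactly three neighbours. -/
def IsCubic {V : Type*} (G : SimpleGraph V) : Prop :=
  ∀ v, (G.neighborSet v).ncard = 3

/-- The graph contains at least one bridge: an edge whose removal disconnects the graph
(for a connected graph, this is Mathlib's `IsBridge`, a cut edge). -/
def HasBridge {V : Type*} (G : SimpleGraph V) : Prop :=
  ∃ e ∈ G.edgeSet, G.IsBridge e

/-- A connected graph without bridges in which the removal of some edge creates a bridge. -/
structure IsBiconnected {V : Type*} (G : SimpleGraph V) : Prop where
  connected : G.Connected
  bridgeless : ¬ HasBridge G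
  exists_edge : ∃ e ∈ G.edgeSet, HasBridge (G.deleteEdges {e})

/-- A bi-bridge: a set `{e, f}` of two edges whose removal disconnects the graph. -/
structure IsBibridge {V : Type*} (G : SimpleGraph V) (e f : Sym2 V) : Prop where
  left_mem : e ∈ G.edgeSet
  right_mem : f ∈ G.edgeSet
  ne : e ≠ f
  disconnects : ¬ (G.deleteEdges {e, f}).Connected

/-- `S` is one of the parts (connected components) left after removing the edges `e` and `f`.
In a connected bridgeless graph a bi-bridge leaves exactly two parts, `S` and its complement. -/
def IsPart {V : Type*} (G : SimpleGraph V) (e f : Sym2 V) (S : Set V) : Prop :=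
  ∃ c : (G.deleteEdges {e, f}).ConnectedComponent, c.supp = S

/-- How far the partition of the vertices into `S` and its complement is from being even. -/
noncomputable def imbalance {V : Type*} (S : Set V) : ℕ :=
  ((S.ncard : ℤ) - (Sᶜ.ncard : ℤ)).natAbs

/-- The edges of `H` that lie on a cycle of `H`. -/
def cycleEdges {W : Type*} (H : SimpleGraph W) : Set (Sym2 W) :=
  {e | ∃ (u : W) (p : H.Walk u u), p.IsCycle ∧ e ∈ p.edges}

/-- Some automorphism of `H` maps `e` to `f`; edges are *distinct* when this fails. -/
def Similar {W : Type*} (H : SimpleGraph W) (e f : Sym2 W) : Prop :=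
  ∃ φ : H ≃g H, e.map φ = f

/-- The number of pairwise distinct edges of `H` on cycles, i.e. the number of automorphism
classes of such edges. -/
noncomputable def numDistinctCycleEdges {W : Type*} (H : SimpleGraph W) : ℕ :=
  ((fun e => {f | Similar H e f}) '' cycleEdges H).ncard

/-- A choice of a bi-bridge `{a₁b₁, a₂b₂}` of `G` that partitions the vertices as evenly as
possible, together with the vertex set `side` of the part `G₁` with more distinct edges on
cycles (ties are broken arbitrarily); `b₁`, `b₂` are the ends of the bi-bridge in that part. -/
structure Split {V : Type*} (G : SimpleGraph V) where
  a₁ : V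
  b₁ : V
  a₂ : V
  b₂ : V
  bibridge : IsBibridge G s(a₁, b₁) s(a₂, b₂)
  side : Set V
  isPart : IsPart G s(a₁, b₁) s(a₂, b₂) side
  a₁_notMem : a₁ ∉ side
  b₁_mem : b₁ ∈ side
  a₂_notMem : a₂ ∉ side
  b₂_mem : b₂ ∈ side
  most_even : ∀ (e f : Sym2 V) (S : Set V), IsBibridge G e f → IsPart G e f S →
    imbalance side ≤ imbalance S
  more_distinct : numDistinctCycleEdges (G.induce sideᶜ) ≤ numDistinctCycleEdges (G.induce side)

namespace Split

variable {V : Type*} {G : SimpleGraph V}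

/-- The graph `G'`: the two edges of the bi-bridge are removed and four vertices
`n₁, n₂, n₃, n₄` (here `inr 0, inr 1, inr 2, inr 3`) are added, with the edges
`a₁n₁, a₂n₁, n₁n₂, n₂n₃, n₂n₄, n₃b₁, n₄b₂`. -/
def splitGraph (s : Split G) : SimpleGraph (V ⊕ Fin 4) :=
  (G.deleteEdges {s(s.a₁, s.b₁), s(s.a₂, s.b₂)}).map Function.Embedding.inl ⊔
    SimpleGraph.fromEdgeSet
      {s(.inl s.a₁, .inr 0), s(.inl s.a₂, .inr 0), s(.inr 0, .inr 1), s(.inr 1, .inr 2),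
        s(.inr 1, .inr 3), s(.inr 2, .inl s.b₁), s(.inr 3, .inl s.b₂)}

/-- The vertices of `G₁'`, the part of `G'` beyond the bridge `n₁n₂` that contains `G₁`. -/
def extSide (s : Split G) : Set (V ⊕ Fin 4) :=
  Sum.inl '' s.side ∪ {.inr 1, .inr 2, .inr 3}

/-- The graph `G₁'`. -/
def extGraph (s : Split G) : SimpleGraph s.extSide :=
  s.splitGraph.induce s.extSide

/-- The edges of `G₁'` that can be used in the edge insertion: they lie on a cycle and do not
contain the two vertices `n₃`, `n₄` of degree two, which are to be joined to their ends. -/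
def candidateEdges (s : Split G) : Set (Sym2 s.extSide) :=
  {e | e ∈ cycleEdges s.extGraph ∧ ∀ v ∈ e, v.1 ≠ .inr 2 ∧ v.1 ≠ .inr 3}

/-- The graph obtained from `G'` by removing the edge `xy` of `G₁'` and joining `x` to `n₃` and
`y` to `n₄`. -/
def insertion (s : Split G) (d : s.extGraph.Dart) : SimpleGraph (V ⊕ Fin 4) :=
  s.splitGraph.deleteEdges {s(d.fst.1, d.snd.1)} ⊔
    SimpleGraph.fromEdgeSet {s(d.fst.1, .inr 2), s(d.snd.1, .inr 3)}

/-- The ordered edge `xy` is admissible: `xy` is a candidate edge, and joining `x` to `n₃` and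
`y` to `n₄` does not double an edge that is already present. -/
structure Admissible (s : Split G) (d : s.extGraph.Dart) : Prop where
  mem : d.edge ∈ s.candidateEdges
  fst_not_adj : ¬ s.splitGraph.Adj d.fst.1 (.inr 2)
  snd_not_adj : ¬ s.splitGraph.Adj d.snd.1 (.inr 3)

end Split

/-- A full set of choices in the construction applied to `G`: a split, and for each automorphism
class of candidate edges of `G₁'` one edge of the class with one admissible order of its ends. -/
structure Run {V : Type*} (G : SimpleGraph V) extends Split G where
  darts : Set toSplit.extGraph.Dart
  admissible : ∀ d ∈ darts, toSplit.Admissible d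
  existsUnique : ∀ e ∈ toSplit.candidateEdges,
    ∃! d : toSplit.extGraph.Dart, d ∈ darts ∧ Similar toSplit.extGraph e d.edge

/-- The graph produced from the chosen ordered edge `d`. -/
def Run.output {V : Type*} {G : SimpleGraph V} (r : Run G) (d : r.toSplit.extGraph.Dart) :
    SimpleGraph (V ⊕ Fin 4) :=
  r.toSplit.insertion d

end BridgeConstruction

/-! In a connected bridgeless graph, a part left by a bi-bridge is a connected set that exactly the
two edges leave (`IsTwoCut`). In a cubic graph these edges have no common end. Hence a most even
split exists, every candidate edge has an admissible order, and each output is cubic. It is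
connected because every deleted edge is replaced by a path through the new vertices, and `n₁n₂` is
the only edge between the two sides.

Growth: automorphisms of `G₁'` preserve its vertices of degree below three, namely `n₂, n₃, n₄`,
hence also the distance to them. As balls in a subcubic graph are bounded, a large `G₁'` has many
distance layers, and edges leaving different layers are distinct (`le_numDistinctCycleEdges`). A
small `G₁` cannot occur for large `n`: its complement would then be bridgeless by evenness of the
split, so by the same layer argument it would have more distinct cycle edges than `G₁` has room for,
against the choice of side.

Selection: every bridge of an output contains a new vertex, so an isomorphism of outputs keeps the
new vertices and the ends `aᵢ, bᵢ, x, y` in a ball of radius three around the new vertices of its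
target (`apply_labels_mem`). If two outputs, mapped to a third, place these ten labels alike, the
composite isomorphism descends to the source graphs (`exists_iso`). Hence the sources coincide and
the inserted edges are similar, so the outputs come from the same dart. Each isomorphism class
therefore holds boundedly many outputs, and Hall's theorem selects `M` from each source
(`exists_selection`). -/

namespace BridgeConstruction

open SimpleGraph

/-! ### Two-edge cuts and the existence of a most even split. -/

section Cuts

variable {V W : Type*} {G : SimpleGraph V}

lemma exists_crossing_edge {u v : V} (h : G.Reachable u v) {X : Set V} (hu : u ∈ X)
    (hv : v ∉ X) : ∃ x ∈ X, ∃ y ∉ X, G.Adj x y := by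
  obtain ⟨p⟩ := h
  obtain ⟨d, -, h₁, h₂⟩ := p.exists_boundary_dart X hu hv
  exact ⟨d.fst, h₁, d.snd, h₂, d.adj⟩

/-- Reachability is transported along a map that sends edges to connected pairs. -/
lemma reachable_map_of_adj {H : SimpleGraph W} (f : V → W)
    (hf : ∀ u v, G.Adj u v → H.Reachable (f u) (f v)) {u v : V} (h : G.Reachable u v) :
    H.Reachable (f u) (f v) := by
  obtain ⟨p⟩ := h
  induction p with
  | nil => exact .rfl
  | cons h _ ih => exact (hf _ _ h).trans ih

/-- An edge that is the only one leaving some vertex set is a bridge. -/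
lemma isBridge_of_unique_crossing {X : Set V} {u v : V} (hu : u ∈ X) (hv : v ∉ X)
    (h : ∀ x ∈ X, ∀ y ∉ X, G.Adj x y → s(x, y) = s(u, v)) : G.IsBridge s(u, v) := by
  rw [isBridge_iff]
  intro hr
  obtain ⟨x, hx, y, hy, hxy⟩ := exists_crossing_edge hr hu hv
  rw [deleteEdges_adj] at hxy
  exact hxy.2 (h x hx y hy hxy.1)

lemma hasBridge_of_unique_crossing {X : Set V} {u v : V} (hu : u ∈ X) (hv : v ∉ X)
    (huv : G.Adj u v) (h : ∀ x ∈ X, ∀ y ∉ X, G.Adj x y → s(x, y) = s(u, v)) : HasBridge G :=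
  ⟨_, huv, isBridge_of_unique_crossing hu hv h⟩

/-- In a connected bridgeless graph, the edges that leave a proper vertex set cannot all be the
same edge. -/
lemma exists_crossing_edge_ne (hc : G.Connected) (hb : ¬ HasBridge G) {X : Set V} {u v : V}
    (hu : u ∈ X) (hv : v ∉ X) (e : Sym2 V) :
    ∃ x ∈ X, ∃ y ∉ X, G.Adj x y ∧ s(x, y) ≠ e := by
  by_contra! h
  obtain ⟨x, hx, y, hy, hxy⟩ := exists_crossing_edge (hc.preconnected u v) hu hv
  refine hb (hasBridge_of_unique_crossing hx hy hxy fun x' hx' y' hy' h' => ?_)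
  rw [h x' hx' y' hy' h', h x hx y hy hxy]

/-- The set `S` is left by exactly the two edges `b₁a₁` and `b₂a₂`. -/
structure IsTwoCut (G : SimpleGraph V) (S : Set V) (a₁ b₁ a₂ b₂ : V) : Prop where
  a₁_notMem : a₁ ∉ S
  b₁_mem : b₁ ∈ S
  a₂_notMem : a₂ ∉ S
  b₂_mem : b₂ ∈ S
  adj₁ : G.Adj a₁ b₁
  adj₂ : G.Adj a₂ b₂
  ne : ¬ (a₁ = a₂ ∧ b₁ = b₂)
  crossing : ∀ u ∈ S, ∀ v ∉ S, G.Adj u v → (u = b₁ ∧ v = a₁) ∨ (u = b₂ ∧ v = a₂)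

namespace IsTwoCut

variable {S : Set V} {a₁ b₁ a₂ b₂ : V}

lemma compl (h : IsTwoCut G S a₁ b₁ a₂ b₂) : IsTwoCut G Sᶜ b₁ a₁ b₂ a₂ where
  a₁_notMem := by simpa using h.b₁_mem
  b₁_mem := h.a₁_notMem
  a₂_notMem := by simpa using h.b₂_mem
  b₂_mem := h.a₂_notMem
  adj₁ := h.adj₁.symm
  adj₂ := h.adj₂.symm
  ne := fun h' => h.ne h'.symm
  crossing u hu v hv huv := by
    have := h.crossing v (by simpa using hv) u hu huv.symm
    tauto

lemma swap (h : IsTwoCut G S a₁ b₁ a₂ b₂) : IsTwoCut G S a₂ b₂ a₁ b₁ where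
  a₁_notMem := h.a₂_notMem
  b₁_mem := h.b₂_mem
  a₂_notMem := h.a₁_notMem
  b₂_mem := h.b₁_mem
  adj₁ := h.adj₂
  adj₂ := h.adj₁
  ne := fun h' => h.ne ⟨h'.1.symm, h'.2.symm⟩
  crossing u hu v hv huv := (h.crossing u hu v hv huv).symm

lemma edge_ne (h : IsTwoCut G S a₁ b₁ a₂ b₂) : s(a₁, b₁) ≠ s(a₂, b₂) := by
  intro he
  rcases Sym2.eq_iff.1 he with h' | h'
  · exact h.ne h'
  · exact h.a₁_notMem (h'.1 ▸ h.b₂_mem)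

/-- In a bridgeless cubic graph the two edges of the cut have no common end. -/
lemma a_ne (h : IsTwoCut G S a₁ b₁ a₂ b₂) (hb : ¬ HasBridge G) (h3 : IsCubic G) : a₁ ≠ a₂ := by
  rintro rfl
  have hbb : b₁ ≠ b₂ := fun h' => h.ne ⟨rfl, h'⟩
  have hsub : ({b₁, b₂} : Set V) ⊆ G.neighborSet a₁ := by
    rintro x (rfl | rfl)
    exacts [h.adj₁, h.adj₂]
  have hfin : (G.neighborSet a₁).Finite := Set.finite_of_ncard_ne_zero (by rw [h3]; simp)
  have hcard : (G.neighborSet a₁ \ {b₁, b₂}).ncard = 1 := by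
    rw [Set.ncard_sdiff hsub (by simp), h3, Set.ncard_pair hbb]
  obtain ⟨c, hc⟩ := Set.ncard_eq_one.1 hcard
  have hc' : G.Adj a₁ c ∧ c ≠ b₁ ∧ c ≠ b₂ := by
    have : c ∈ G.neighborSet a₁ \ {b₁, b₂} := by rw [hc]; rfl
    simpa using this
  have hall : ∀ y, G.Adj a₁ y → y = b₁ ∨ y = b₂ ∨ y = c := by
    intro y hy
    by_contra! h'
    have : y ∈ G.neighborSet a₁ \ {b₁, b₂} := by simp [hy, h'.1, h'.2.1]
    rw [hc] at this
    exact h'.2.2 this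
  have hcS : c ∉ S := fun hcS => by
    have := h.crossing c hcS a₁ h.a₁_notMem hc'.1.symm
    tauto
  -- The third neighbour `c` of the common end lies outside `S`, so `a₁c` is the only edge leaving
  -- `S ∪ {a₁}`.
  refine hb (hasBridge_of_unique_crossing (X := insert a₁ S) (u := a₁) (v := c) (by simp) ?_
    hc'.1 ?_)
  · simp [hcS, hc'.1.ne']
  · rintro x hx y hy hxy
    simp only [Set.mem_insert_iff, not_or] at hx hy
    rcases hx with rfl | hx
    · rcases hall y hxy with rfl | rfl | rfl
      exacts [(hy.2 h.b₁_mem).elim, (hy.2 h.b₂_mem).elim, rfl]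
    · have := h.crossing x hx y hy.2 hxy
      tauto

lemma b_ne (h : IsTwoCut G S a₁ b₁ a₂ b₂) (hb : ¬ HasBridge G) (h3 : IsCubic G) : b₁ ≠ b₂ :=
  h.compl.a_ne hb h3

/-- The side `S` of the cut induces a connected graph. -/
lemma connected_induce (h : IsTwoCut G S a₁ b₁ a₂ b₂) (hc : G.Connected) (hb : ¬ HasBridge G) :
    (G.induce S).Connected := by
  have key : ∀ v (hv : v ∈ S), (G.induce S).Reachable ⟨v, hv⟩ ⟨b₁, h.b₁_mem⟩ := by
    intro v hv
    by_contra hn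
    -- The component of `v` within `S`. If it misses `b₁`, only `b₂a₂` can leave it, which would
    -- make that edge a bridge.
    let X : Set V := {w | ∃ hw : w ∈ S, (G.induce S).Reachable ⟨v, hv⟩ ⟨w, hw⟩}
    obtain ⟨x, ⟨hxS, hx⟩, y, hy, hxy, hne⟩ := exists_crossing_edge_ne hc hb (X := X)
      (u := v) (v := b₁) ⟨hv, .rfl⟩ (fun h' => hn h'.2) s(a₂, b₂)
    have hyS : y ∉ S := fun hyS => hy ⟨hyS, hx.trans (Adj.reachable (by simpa using hxy))⟩
    rcases h.crossing x hxS y hyS hxy with ⟨rfl, rfl⟩ | ⟨rfl, rfl⟩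
    · exact hn hx
    · exact hne Sym2.eq_swap
  exact (connected_iff_exists_forall_reachable _).2 ⟨⟨b₁, h.b₁_mem⟩, fun w => (key w.1 w.2).symm⟩

lemma not_adj_deleteEdges (h : IsTwoCut G S a₁ b₁ a₂ b₂) {u v : V} (hu : u ∈ S) (hv : v ∉ S) :
    ¬ (G.deleteEdges {s(a₁, b₁), s(a₂, b₂)}).Adj u v := by
  rw [deleteEdges_adj]
  rintro ⟨huv, hn⟩
  rcases h.crossing u hu v hv huv with ⟨rfl, rfl⟩ | ⟨rfl, rfl⟩
  · exact hn (by simp [Sym2.eq_swap])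
  · exact hn (by simp [Sym2.eq_swap])

lemma not_reachable_deleteEdges (h : IsTwoCut G S a₁ b₁ a₂ b₂) {u v : V} (hu : u ∈ S)
    (hv : v ∉ S) : ¬ (G.deleteEdges {s(a₁, b₁), s(a₂, b₂)}).Reachable u v := by
  intro hr
  obtain ⟨x, hx, y, hy, hxy⟩ := exists_crossing_edge hr hu hv
  exact h.not_adj_deleteEdges hx hy hxy

lemma isBibridge (h : IsTwoCut G S a₁ b₁ a₂ b₂) : IsBibridge G s(a₁, b₁) s(a₂, b₂) where
  left_mem := h.adj₁
  right_mem := h.adj₂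
  ne := h.edge_ne
  disconnects hc := h.not_reachable_deleteEdges h.b₁_mem h.a₁_notMem (hc.preconnected _ _)

/-- A walk inside `S` uses no edge of the cut. -/
lemma reachable_deleteEdges (h : IsTwoCut G S a₁ b₁ a₂ b₂) (hc : G.Connected)
    (hb : ¬ HasBridge G) {u v : V} (hu : u ∈ S) (hv : v ∈ S) :
    (G.deleteEdges {s(a₁, b₁), s(a₂, b₂)}).Reachable u v := by
  refine reachable_map_of_adj (G := G.induce S) Subtype.val ?_
    ((h.connected_induce hc hb).preconnected ⟨u, hu⟩ ⟨v, hv⟩)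
  rintro ⟨x, hx⟩ ⟨y, hy⟩ hxy
  refine Adj.reachable (deleteEdges_adj.2 ⟨by simpa using hxy, ?_⟩)
  have h₁ := h.a₁_notMem
  have h₂ := h.a₂_notMem
  rintro (he | he) <;>
  · rcases Sym2.eq_iff.1 he with ⟨rfl, rfl⟩ | ⟨rfl, rfl⟩ <;> contradiction

lemma supp_eq (h : IsTwoCut G S a₁ b₁ a₂ b₂) (hc : G.Connected) (hb : ¬ HasBridge G) {u : V}
    (hu : u ∈ S) :
    ((G.deleteEdges {s(a₁, b₁), s(a₂, b₂)}).connectedComponentMk u).supp = S := by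
  ext v
  rw [ConnectedComponent.mem_supp_iff, ConnectedComponent.eq]
  refine ⟨fun hr => ?_, fun hv => h.reachable_deleteEdges hc hb hv hu⟩
  by_contra hv
  exact h.not_reachable_deleteEdges hu hv hr.symm

lemma isPart (h : IsTwoCut G S a₁ b₁ a₂ b₂) (hc : G.Connected) (hb : ¬ HasBridge G) :
    IsPart G s(a₁, b₁) s(a₂, b₂) S :=
  ⟨_, h.supp_eq hc hb h.b₁_mem⟩

end IsTwoCut

lemma IsPart.mem_of_adj {S : Set V} {e f : Sym2 V} (h : IsPart G e f S) {u v : V} (hu : u ∈ S)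
    (hv : v ∉ S) (huv : G.Adj u v) : s(u, v) = e ∨ s(u, v) = f := by
  obtain ⟨c, rfl⟩ := h
  by_contra hn
  refine hv (c.mem_supp_of_adj_mem_supp hu ?_)
  rw [deleteEdges_adj]
  exact ⟨huv, hn⟩

/-- A part left by a bi-bridge of a connected bridgeless graph is left by both of its edges. -/
lemma IsPart.exists_isTwoCut (hc : G.Connected) (hb : ¬ HasBridge G) {S : Set V} {e f : Sym2 V}
    (hef : IsBibridge G e f) (h : IsPart G e f S) :
    ∃ a₁ b₁ a₂ b₂, s(a₁, b₁) = e ∧ s(a₂, b₂) = f ∧ IsTwoCut G S a₁ b₁ a₂ b₂ := by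
  have hcr := @IsPart.mem_of_adj _ _ _ _ _ h
  obtain ⟨u, hu⟩ : S.Nonempty := by
    obtain ⟨c, rfl⟩ := h
    exact c.nonempty_supp
  obtain ⟨v, hv⟩ : ∃ v, v ∉ S := by
    by_contra! hall
    obtain ⟨c, rfl⟩ := h
    refine hef.disconnects ((connected_iff_exists_forall_reachable _).2 ⟨u, fun w => ?_⟩)
    have h₁ := hall w
    rw [ConnectedComponent.mem_supp_iff] at hu h₁
    exact ConnectedComponent.exact (hu.trans h₁.symm)
  -- No single edge separates `S` from the rest: a crossing edge other than `e` must be `f`, and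
  -- conversely.
  obtain ⟨b₂, hb₂, a₂, ha₂, h₂, hne₂⟩ := exists_crossing_edge_ne hc hb hu hv e
  obtain ⟨b₁, hb₁, a₁, ha₁, h₁, hne₁⟩ := exists_crossing_edge_ne hc hb hu hv f
  have he : s(b₁, a₁) = e := (hcr hb₁ ha₁ h₁).resolve_right hne₁
  have hf : s(b₂, a₂) = f := (hcr hb₂ ha₂ h₂).resolve_left hne₂
  refine ⟨a₁, b₁, a₂, b₂, Sym2.eq_swap.trans he, Sym2.eq_swap.trans hf, ha₁, hb₁, ha₂, hb₂,
    h₁.symm, h₂.symm, ?_, ?_⟩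
  · rintro ⟨rfl, rfl⟩
    exact hne₁ hf
  · intro x hx y hy hxy
    rcases hcr hx hy hxy with h' | h'
    · rw [← he] at h'
      rcases Sym2.eq_iff.1 h' with h' | ⟨rfl, rfl⟩
      · exact .inl h'
      · contradiction
    · rw [← hf] at h'
      rcases Sym2.eq_iff.1 h' with h' | ⟨rfl, rfl⟩
      · exact .inr h'
      · contradiction

lemma Split.isTwoCut (s : Split G) :
    IsTwoCut G s.side s.a₁ s.b₁ s.a₂ s.b₂ where
  a₁_notMem := s.a₁_notMem
  b₁_mem := s.b₁_mem
  a₂_notMem := s.a₂_notMem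
  b₂_mem := s.b₂_mem
  adj₁ := s.bibridge.left_mem
  adj₂ := s.bibridge.right_mem
  ne := fun h => s.bibridge.ne (by rw [h.1, h.2])
  crossing u hu v hv huv := by
    have h₁ := s.a₁_notMem
    have h₂ := s.a₂_notMem
    rcases s.isPart.mem_of_adj hu hv huv with h' | h' <;>
      rcases Sym2.eq_iff.1 h' with ⟨rfl, rfl⟩ | ⟨rfl, rfl⟩
    · contradiction
    · exact .inl ⟨rfl, rfl⟩
    · contradiction
    · exact .inr ⟨rfl, rfl⟩

lemma imbalance_compl (S : Set V) : imbalance Sᶜ = imbalance S := by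
  unfold imbalance
  rw [compl_compl]
  omega

/-- Every biconnected graph has a split. -/
lemma exists_split (hG : IsBiconnected G) : Nonempty (Split G) := by
  have hc := hG.connected
  have hb := hG.bridgeless
  have hex : ∃ k : ℕ, ∃ (e f : Sym2 V) (S : Set V), IsBibridge G e f ∧ IsPart G e f S ∧
      imbalance S = k := by
    obtain ⟨e, he, f, hf, hbr⟩ := hG.exists_edge
    have hbi : IsBibridge G e f := by
      rw [edgeSet_deleteEdges] at hf
      refine ⟨he, hf.1, fun h => hf.2 h.symm, fun hcon => ?_⟩
      induction f with | h u v
      rw [isBridge_iff, deleteEdges_deleteEdges] at hbr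
      exact hbr (hcon.preconnected u v)
    obtain ⟨v⟩ := hc.nonempty
    exact ⟨_, e, f, _, hbi, ⟨connectedComponentMk _ v, rfl⟩, rfl⟩
  classical
  obtain ⟨e, f, S, hef, hS, hk⟩ := Nat.find_spec hex
  have hmin : ∀ (e f : Sym2 V) (T : Set V), IsBibridge G e f → IsPart G e f T →
      imbalance S ≤ imbalance T := fun e f T h₁ h₂ =>
    hk.trans_le (Nat.find_min' hex ⟨e, f, T, h₁, h₂, rfl⟩)
  obtain ⟨a₁, b₁, a₂, b₂, rfl, rfl, h⟩ := hS.exists_isTwoCut hc hb hef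
  rcases le_total (numDistinctCycleEdges (G.induce Sᶜ)) (numDistinctCycleEdges (G.induce S))
    with hle | hle
  · exact ⟨⟨a₁, b₁, a₂, b₂, hef, S, hS, h.a₁_notMem, h.b₁_mem, h.a₂_notMem, h.b₂_mem, hmin, hle⟩⟩
  -- Passing to the other side keeps the split most even, as `imbalance` is symmetric under
  -- complement.
  · have h' := h.compl
    refine ⟨⟨b₁, a₁, b₂, a₂, h'.isBibridge, Sᶜ, h'.isPart hc hb, h'.a₁_notMem, h'.b₁_mem,
      h'.a₂_notMem, h'.b₂_mem, ?_, ?_⟩⟩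
    · rwa [imbalance_compl]
    · rwa [compl_compl]

end Cuts

/-! ### Distance layers and the number of distinct edges on cycles. -/

section Growth

variable {V W : Type*} {H : SimpleGraph W}

lemma similar_refl (e : Sym2 W) : Similar H e e := ⟨Iso.refl, by simp [Iso.refl]⟩

lemma Similar.symm {e f : Sym2 W} (h : Similar H e f) : Similar H f e := by
  obtain ⟨φ, rfl⟩ := h
  refine ⟨φ.symm, ?_⟩
  have h : φ.symm ∘ φ = id := by
    ext x
    simp
  rw [Sym2.map_map, h, Sym2.map_id, id]

lemma Similar.trans {e f g : Sym2 W} (h : Similar H e f) (h' : Similar H f g) :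
    Similar H e g := by
  obtain ⟨φ, rfl⟩ := h
  obtain ⟨ψ, rfl⟩ := h'
  exact ⟨φ.trans ψ, by rw [Sym2.map_map]; rfl⟩

lemma setOf_similar_eq_iff {e f : Sym2 W} :
    {g | Similar H e g} = {g | Similar H f g} ↔ Similar H e f := by
  constructor
  · intro h
    have : f ∈ {g | Similar H e g} := h ▸ similar_refl f
    exact this
  · intro h
    ext g
    exact ⟨h.symm.trans, h.trans⟩

lemma mem_cycleEdges_of_not_isBridge {u v : W} (huv : H.Adj u v) (h : ¬ H.IsBridge s(u, v)) :
    s(u, v) ∈ cycleEdges H := by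
  rw [isBridge_iff_forall_cycle_notMem huv] at h
  push Not at h
  exact h

/-- The vertices at distance at most `k` from the set `T`. -/
def setBall (H : SimpleGraph W) (T : Set W) : ℕ → Set W
  | 0 => T
  | k + 1 => setBall H T k ∪ {v | ∃ u ∈ setBall H T k, H.Adj u v}

lemma setBall_subset_succ (T : Set W) (k : ℕ) : setBall H T k ⊆ setBall H T (k + 1) :=
  Set.subset_union_left

lemma setBall_mono (T : Set W) : Monotone (setBall H T) :=
  monotone_nat_of_le_succ (setBall_subset_succ T)

lemma mem_setBall_succ_of_adj {T : Set W} {k : ℕ} {u v : W} (hu : u ∈ setBall H T k)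
    (h : H.Adj u v) : v ∈ setBall H T (k + 1) :=
  .inr ⟨u, hu, h⟩

/-- Each vertex of a ball contributes itself and at most three neighbours to the next ball, hence
the factor 4. -/
lemma ncard_setBall_le [Finite W] (h3 : ∀ v, (H.neighborSet v).ncard ≤ 3) (T : Set W) (k : ℕ) :
    (setBall H T k).ncard ≤ T.ncard * 4 ^ k := by
  classical
  have := Fintype.ofFinite W
  induction k with
  | zero => simp [setBall]
  | succ k ih =>
    have h : {v | ∃ u ∈ setBall H T k, H.Adj u v}.ncard ≤ (setBall H T k).ncard * 3 := by
      have he : {v | ∃ u ∈ setBall H T k, H.Adj u v} =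
          ↑((setBall H T k).toFinset.biUnion fun u => (H.neighborSet u).toFinset) := by
        ext v
        simp
      rw [he, Set.ncard_coe_finset, Set.ncard_eq_toFinset_card']
      refine Finset.card_biUnion_le_card_mul _ _ _ fun u _ => ?_
      rw [← Set.ncard_eq_toFinset_card']
      exact h3 u
    calc (setBall H T (k + 1)).ncard
        ≤ (setBall H T k).ncard + {v | ∃ u ∈ setBall H T k, H.Adj u v}.ncard :=
          Set.ncard_union_le _ _
      _ ≤ T.ncard * 4 ^ (k + 1) := by
          rw [pow_succ, ← mul_assoc]
          omega

/-- Distance to an invariant set is itself invariant; this is what tells edges of different layers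
apart. -/
lemma apply_mem_setBall_iff {T : Set W} (φ : H ≃g H) (hφ : ∀ v, φ v ∈ T ↔ v ∈ T) (k : ℕ) (v : W) :
    φ v ∈ setBall H T k ↔ v ∈ setBall H T k := by
  induction k generalizing v with
  | zero => exact hφ v
  | succ k ih =>
    simp only [setBall, Set.mem_union, ih, Set.mem_ofPred_eq]
    refine or_congr Iff.rfl ⟨?_, ?_⟩
    · rintro ⟨u, hu, huv⟩
      refine ⟨φ.symm u, by rw [← ih]; simpa using hu, ?_⟩
      rw [← φ.map_adj_iff]
      simpa using huv
    · rintro ⟨u, hu, huv⟩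
      exact ⟨φ u, (ih u).2 hu, φ.map_adj_iff.2 huv⟩

lemma ncard_neighborSet_apply {H' : SimpleGraph V} (φ : H ≃g H') (v : W) :
    (H'.neighborSet (φ v)).ncard = (H.neighborSet v).ncard := by
  rw [← Set.ncard_image_of_injective _ φ.injective]
  congr 1
  ext w
  constructor
  · intro hw
    refine ⟨φ.symm w, ?_, by simp⟩
    rw [mem_neighborSet, ← φ.map_adj_iff]
    simpa using hw
  · rintro ⟨w, hw, rfl⟩
    exact φ.map_adj_iff.2 hw

/-- A large connected subcubic graph with few vertices of degree less than three has many
pairwise distinct edges on cycles, provided that every edge between vertices of degree three is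
on a cycle: edges at different distances from the vertices of smaller degree are distinct. -/
lemma le_numDistinctCycleEdges [Finite W] (hc : H.Preconnected)
    (h3 : ∀ v, (H.neighborSet v).ncard ≤ 3) (hT : {v | (H.neighborSet v).ncard ≠ 3}.Nonempty)
    (hT3 : {v | (H.neighborSet v).ncard ≠ 3}.ncard ≤ 3)
    (hcyc : ∀ u v, H.Adj u v → (H.neighborSet u).ncard = 3 → (H.neighborSet v).ncard = 3 →
      s(u, v) ∈ cycleEdges H) {M : ℕ} (hM : 3 * 4 ^ (M + 1) < Nat.card W) :
    M ≤ numDistinctCycleEdges H := by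
  set T := {v | (H.neighborSet v).ncard ≠ 3}
  have hinv : ∀ (φ : H ≃g H) v, φ v ∈ T ↔ v ∈ T := fun φ v => by
    simp only [T, Set.mem_ofPred_eq, ncard_neighborSet_apply]
  -- A ball of radius `k ≤ M` is too small to contain every vertex, so connectedness yields an edge
  -- leaving it.
  have hex : ∀ k, k ≤ M → ∃ u v, H.Adj u v ∧ u ∈ setBall H T k ∧ v ∉ setBall H T k := by
    intro k hk
    obtain ⟨t, ht⟩ := hT
    obtain ⟨w, hw⟩ : ∃ w, w ∉ setBall H T k := by
      by_contra! hall
      have h₁ := ncard_setBall_le h3 T k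
      rw [Set.eq_univ_of_forall hall, Set.ncard_univ] at h₁
      have h₂ : T.ncard * 4 ^ k ≤ 3 * 4 ^ (M + 1) :=
        Nat.mul_le_mul hT3 (Nat.pow_le_pow_right (by simp) (by omega))
      omega
    obtain ⟨u, hu, v, hv, huv⟩ :=
      exists_crossing_edge (hc t w) (setBall_mono T (Nat.zero_le k) ht) hw
    exact ⟨u, v, huv, hu, hv⟩
  have : Nonempty W := hT.nonempty
  choose! u v huv hu hv using hex
  have hu' : ∀ k, k + 1 ≤ M → u (k + 1) ∉ setBall H T k := fun k hk h =>
    hv _ hk (mem_setBall_succ_of_adj h (huv _ hk))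
  -- The shift by one puts both ends of `e k` outside the ball of radius `k`, hence outside `T`;
  -- they have degree three and `hcyc` applies.
  let e : Fin M → Sym2 W := fun k => s(u (k + 1), v (k + 1))
  have he : ∀ k, e k ∈ cycleEdges H := by
    intro k
    have hT' : ∀ w, w ∉ setBall H T k → (H.neighborSet w).ncard = 3 := by
      intro w hw
      by_contra h
      exact hw (setBall_mono T (Nat.zero_le k) h)
    exact hcyc _ _ (huv _ k.2) (hT' _ (hu' _ k.2))
      (hT' _ fun h => hv _ k.2 (setBall_subset_succ T _ h))
  -- Both ends of `e k` are in the ball of radius `k + 2 ≤ l + 1`, whereas the outer end of `e l` is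
  -- not in the ball of radius `l + 1`.
  have hlt : ∀ k l : Fin M, k < l → ¬ Similar H (e l) (e k) := by
    rintro k l hkl ⟨φ, hφ⟩
    have hmem : ∀ w ∈ e k, w ∈ setBall H T (l + 1) := by
      intro w hw
      refine setBall_mono T (show (k : ℕ) + 2 ≤ l + 1 by have : (k : ℕ) < l := hkl; omega) ?_
      rcases Sym2.mem_iff.1 hw with rfl | rfl
      · exact setBall_subset_succ T _ (hu _ k.2)
      · exact mem_setBall_succ_of_adj (hu _ k.2) (huv _ k.2)
    have h' := hmem (φ (v (l + 1))) (hφ ▸ Sym2.mem_map.2 ⟨_, Sym2.mem_mk_right _ _, rfl⟩)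
    rw [apply_mem_setBall_iff φ (hinv φ)] at h'
    exact hv _ l.2 h'
  have hinj : Function.Injective fun k => {f | Similar H (e k) f} := by
    intro k l hkl
    have hs := setOf_similar_eq_iff.1 hkl
    rcases lt_trichotomy k l with h | h | h
    exacts [(hlt k l h hs.symm).elim, h, (hlt l k h hs).elim]
  calc M = (Set.range fun k => {f | Similar H (e k) f}).ncard := by
        rw [← Set.image_univ, Set.ncard_image_of_injective _ hinj, Set.ncard_univ, Nat.card_fin]
    _ ≤ _ := Set.ncard_le_ncard (by rintro _ ⟨k, rfl⟩; exact ⟨e k, he k, rfl⟩) (Set.toFinite _)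

/-- A crude bound suffices: it only serves to show that a small part has few classes. -/
lemma numDistinctCycleEdges_le [Finite W] : numDistinctCycleEdges H ≤ Nat.card W ^ 2 := by
  calc numDistinctCycleEdges H ≤ (cycleEdges H).ncard := Set.ncard_image_le (Set.toFinite _)
    _ ≤ Nat.card (Sym2 W) := Set.ncard_le_card _
    _ ≤ Nat.card (W × W) :=
      Nat.card_le_card_of_surjective (fun p : W × W => s(p.1, p.2)) fun e => by
        induction e with | h u v; exact ⟨(u, v), rfl⟩
    _ = Nat.card W ^ 2 := by rw [Nat.card_prod, sq]

lemma ncard_pair_le (x y : W) : ({x, y} : Set W).ncard ≤ 2 :=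
  (Set.ncard_insert_le _ _).trans (by rw [Set.ncard_singleton])

lemma ncard_neighborSet_induce (S : Set W) (v : S) :
    ((H.induce S).neighborSet v).ncard = (H.neighborSet v ∩ S).ncard := by
  rw [← Set.ncard_image_of_injective _ Subtype.val_injective]
  congr 1
  ext w
  simp only [Set.mem_image, mem_neighborSet, comap_adj, Function.Embedding.subtype_apply,
    Subtype.exists, exists_and_right, exists_eq_right, Set.mem_inter_iff]
  exact ⟨fun ⟨h, h'⟩ => ⟨h', h⟩, fun ⟨h, h'⟩ => ⟨h', h⟩⟩

end Growth

/-! ### Degrees, connectedness and cycles of `G₁'`. -/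

section Extension

variable {V : Type*} {G : SimpleGraph V}

namespace Split

variable (s : Split G)

@[simp] lemma splitGraph_inl_inl (u v : V) : s.splitGraph.Adj (.inl u) (.inl v) ↔
    G.Adj u v ∧ s(u, v) ≠ s(s.a₁, s.b₁) ∧ s(u, v) ≠ s(s.a₂, s.b₂) := by
  simp [splitGraph]

@[simp] lemma splitGraph_inl_inr (u : V) (k : Fin 4) : s.splitGraph.Adj (.inl u) (.inr k) ↔
    (u = s.a₁ ∧ k = 0) ∨ (u = s.a₂ ∧ k = 0) ∨ (u = s.b₁ ∧ k = 2) ∨ (u = s.b₂ ∧ k = 3) := by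
  simp [splitGraph]

@[simp] lemma splitGraph_inr_inl (u : V) (k : Fin 4) : s.splitGraph.Adj (.inr k) (.inl u) ↔
    (u = s.a₁ ∧ k = 0) ∨ (u = s.a₂ ∧ k = 0) ∨ (u = s.b₁ ∧ k = 2) ∨ (u = s.b₂ ∧ k = 3) := by
  rw [adj_comm, splitGraph_inl_inr]

@[simp] lemma splitGraph_inr_inr (j k : Fin 4) : s.splitGraph.Adj (.inr j) (.inr k) ↔
    (j = 0 ∧ k = 1) ∨ (j = 1 ∧ k = 0) ∨ (j = 1 ∧ k = 2) ∨ (j = 2 ∧ k = 1) ∨ (j = 1 ∧ k = 3) ∨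
      (j = 3 ∧ k = 1) := by
  simp [splitGraph]
  fin_cases j <;> fin_cases k <;> simp

@[simp] lemma inl_mem_extSide (u : V) : .inl u ∈ s.extSide ↔ u ∈ s.side := by simp [extSide]

@[simp] lemma inr_mem_extSide (k : Fin 4) : .inr k ∈ s.extSide ↔ k ≠ 0 := by
  simp [extSide]
  fin_cases k <;> simp

/-- The inclusion of the chosen part into the vertices of `G₁'`. -/
def inlExt (u : s.side) : s.extSide := ⟨.inl u, by simp⟩

/-- The vertices `n₂, n₃, n₄` of `G₁'`. -/
def newExt (k : Fin 4) (hk : k ≠ 0) : s.extSide := ⟨.inr k, by simpa⟩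

lemma extGraph_adj (u v : s.extSide) : s.extGraph.Adj u v ↔ s.splitGraph.Adj u.1 v.1 := Iff.rfl

lemma extSide_cases {p : s.extSide → Prop} (h : ∀ u, p (s.inlExt u))
    (h' : ∀ k hk, p (s.newExt k hk)) (v : s.extSide) : p v := by
  obtain ⟨v | k, hv⟩ := v
  · exact h ⟨v, by simpa using hv⟩
  · exact h' k (by simpa using hv)

lemma ne_edge_of_mem {u v : V} (hu : u ∈ s.side) (hv : v ∈ s.side) :
    s(u, v) ≠ s(s.a₁, s.b₁) ∧ s(u, v) ≠ s(s.a₂, s.b₂) := by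
  have h₁ := s.a₁_notMem
  have h₂ := s.a₂_notMem
  constructor <;> intro he <;>
    rcases Sym2.eq_iff.1 he with ⟨rfl, rfl⟩ | ⟨rfl, rfl⟩ <;> contradiction

lemma extGraph_inlExt (u v : s.side) :
    s.extGraph.Adj (s.inlExt u) (s.inlExt v) ↔ G.Adj u v := by
  simp only [extGraph_adj, inlExt, splitGraph_inl_inl]
  exact and_iff_left (s.ne_edge_of_mem u.2 v.2)

variable {s}

/-- The map `ρ` replaces the neighbour across the cut by `n₃` at `b₁` and by `n₄` at `b₂`. It is
injective on neighbours because `b₁ ≠ b₂` allows each vertex at most one crossing edge. -/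
lemma ncard_neighborSet_inlExt (hb : ¬ HasBridge G) (h3 : IsCubic G) (u : s.side) :
    (s.extGraph.neighborSet (s.inlExt u)).ncard = 3 := by
  classical
  have hcut := s.isTwoCut
  have hbb := hcut.b_ne hb h3
  obtain ⟨u, hu⟩ := u
  unfold extGraph
  rw [ncard_neighborSet_induce, ← h3 u]
  let ρ : V → V ⊕ Fin 4 := fun w =>
    if w ∈ s.side then .inl w else if u = s.b₁ then .inr 2 else .inr 3
  have hinj : Set.InjOn ρ (G.neighborSet u) := by
    intro w hw w' hw' h
    by_cases h₁ : w ∈ s.side <;> by_cases h₂ : w' ∈ s.side <;> simp only [ρ, h₁, h₂, if_true,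
      if_false] at h
    · simpa using h
    · split_ifs at h
    · split_ifs at h
    · have h₃ := hcut.crossing u hu w h₁ hw
      have h₄ := hcut.crossing u hu w' h₂ hw'
      grind
  rw [← hinj.ncard_image]
  congr 1
  ext w
  simp only [inlExt, Set.mem_inter_iff, mem_neighborSet, Set.mem_image]
  constructor
  · rintro ⟨h, h'⟩
    obtain w | k := w
    · simp only [splitGraph_inl_inl, inl_mem_extSide] at h h'
      exact ⟨w, h.1, by simp [ρ, h']⟩
    · simp only [splitGraph_inl_inr, inr_mem_extSide] at h h'
      rcases h with ⟨-, rfl⟩ | ⟨-, rfl⟩ | ⟨rfl, rfl⟩ | ⟨rfl, rfl⟩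
      · simp at h'
      · simp at h'
      · exact ⟨s.a₁, hcut.adj₁.symm, by simp [ρ, s.a₁_notMem]⟩
      · exact ⟨s.a₂, hcut.adj₂.symm, by simp [ρ, s.a₂_notMem, hbb.symm]⟩
  · rintro ⟨w, hw, rfl⟩
    by_cases h₁ : w ∈ s.side
    · simp [ρ, h₁, hw, s.ne_edge_of_mem hu h₁]
    · rcases hcut.crossing u hu w h₁ hw with ⟨rfl, rfl⟩ | ⟨rfl, rfl⟩
      · simp [ρ, h₁]
      · simp [ρ, h₁, hbb.symm]

lemma ncard_neighborSet_newExt (k : Fin 4) (hk : k ≠ 0) :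
    (s.extGraph.neighborSet (s.newExt k hk)).ncard ≤ 2 := by
  unfold extGraph
  rw [ncard_neighborSet_induce]
  have key : ∀ x y : V ⊕ Fin 4, s.splitGraph.neighborSet (s.newExt k hk).1 ∩ s.extSide ⊆ {x, y} →
      (s.splitGraph.neighborSet (s.newExt k hk).1 ∩ s.extSide).ncard ≤ 2 := fun x y h =>
    (Set.ncard_le_ncard h (Set.toFinite _)).trans (ncard_pair_le x y)
  have hk' : k = 1 ∨ k = 2 ∨ k = 3 := by omega
  rcases hk' with rfl | rfl | rfl
  · refine key (.inr 2) (.inr 3) ?_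
    rintro (w | j) <;> simp [newExt]
    omega
  · refine key (.inl s.b₁) (.inr 1) ?_
    rintro (w | j) <;> simp +contextual [newExt]
  · refine key (.inl s.b₂) (.inr 1) ?_
    rintro (w | j) <;> simp +contextual [newExt]

lemma setOf_ncard_neighborSet_ext_ne (hb : ¬ HasBridge G) (h3 : IsCubic G) :
    {v | (s.extGraph.neighborSet v).ncard ≠ 3} =
      {s.newExt 1 (by simp), s.newExt 2 (by simp), s.newExt 3 (by simp)} := by
  ext v
  induction v using s.extSide_cases with
  | h u =>
    simp only [Set.mem_ofPred_eq, ncard_neighborSet_inlExt hb h3]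
    simp [inlExt, newExt]
  | h' k hk =>
    have := s.ncard_neighborSet_newExt k hk
    have hk' : k = 1 ∨ k = 2 ∨ k = 3 := by omega
    simp only [Set.mem_ofPred_eq, Set.mem_insert_iff, Set.mem_singleton_iff, newExt,
      Subtype.mk.injEq, Sum.inr.injEq, hk', iff_true]
    exact fun h => by simp only [newExt] at this; omega

lemma reachable_inlExt (hc : G.Connected) (hb : ¬ HasBridge G) (u v : s.side) :
    s.extGraph.Reachable (s.inlExt u) (s.inlExt v) :=
  reachable_map_of_adj _ (fun _ _ h => ((s.extGraph_inlExt _ _).2 h).reachable)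
    ((s.isTwoCut.connected_induce hc hb).preconnected u v)

lemma extGraph_connected (hc : G.Connected) (hb : ¬ HasBridge G) : s.extGraph.Connected := by
  let b₁ : s.side := ⟨s.b₁, s.b₁_mem⟩
  let b₂ : s.side := ⟨s.b₂, s.b₂_mem⟩
  have h₃ : s.extGraph.Reachable (s.inlExt b₁) (s.newExt 2 (by simp)) :=
    Adj.reachable (by simp [extGraph_adj, inlExt, newExt, b₁])
  have h₄ : s.extGraph.Reachable (s.inlExt b₂) (s.newExt 3 (by simp)) :=
    Adj.reachable (by simp [extGraph_adj, inlExt, newExt, b₂])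
  have h₂ : s.extGraph.Reachable (s.newExt 2 (by simp)) (s.newExt 1 (by simp)) :=
    Adj.reachable (by simp [extGraph_adj, newExt])
  refine (connected_iff_exists_forall_reachable _).2 ⟨s.inlExt b₁, fun v => ?_⟩
  induction v using s.extSide_cases with
  | h u => exact reachable_inlExt hc hb b₁ u
  | h' k hk =>
    have hk' : k = 1 ∨ k = 2 ∨ k = 3 := by omega
    rcases hk' with rfl | rfl | rfl
    · exact h₃.trans h₂
    · exact h₃
    · exact (reachable_inlExt hc hb b₁ b₂).trans h₄

/-- Contracting the other part to `n₂` shows that the edges inside the chosen part are no bridges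
of `G₁'`. -/
lemma mem_cycleEdges_inlExt (hb : ¬ HasBridge G) {u v : s.side}
    (huv : G.Adj u v) : s(s.inlExt u, s.inlExt v) ∈ cycleEdges s.extGraph := by
  classical
  refine mem_cycleEdges_of_not_isBridge ((s.extGraph_inlExt _ _).2 huv) ?_
  rw [isBridge_iff, not_not]
  have hr : (G.deleteEdges {s(u.1, v.1)}).Reachable u v := by
    by_contra h
    exact hb ⟨s(u.1, v.1), huv, h⟩
  let H := s.extGraph.deleteEdges {s(s.inlExt u, s.inlExt v)}
  let f : V → s.extSide := fun w => if hw : w ∈ s.side then s.inlExt ⟨w, hw⟩ else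
    s.newExt 1 (by simp)
  -- A cut edge becomes a path of length two to `n₂`, through `n₃` or `n₄`; neither step is the
  -- removed edge.
  have hnew : ∀ x : s.side, ∀ k hk j hj, s.extGraph.Adj (s.inlExt x) (s.newExt k hk) →
      s.extGraph.Adj (s.newExt k hk) (s.newExt j hj) →
      H.Reachable (s.inlExt x) (s.newExt j hj) := by
    intro x k hk j hj h₁ h₂
    refine (Adj.reachable (deleteEdges_adj.2 ⟨h₁, ?_⟩)).trans
      (Adj.reachable (deleteEdges_adj.2 ⟨h₂, ?_⟩)) <;>
    simp [inlExt, newExt]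
  have hcross : ∀ x ∈ s.side, ∀ y ∉ s.side, G.Adj x y → H.Reachable (f x) (f y) := by
    intro x hx y hy hxy
    simp only [f, hx, hy, dif_pos, dif_neg, not_false_eq_true]
    rcases s.isTwoCut.crossing x hx y hy hxy with ⟨rfl, rfl⟩ | ⟨rfl, rfl⟩
    · exact hnew _ 2 (by simp) _ _ (by simp [extGraph_adj, inlExt, newExt])
        (by simp [extGraph_adj, newExt])
    · exact hnew _ 3 (by simp) _ _ (by simp [extGraph_adj, inlExt, newExt])
        (by simp [extGraph_adj, newExt])
  have hfu : f u = s.inlExt u := by simp [f]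
  have hfv : f v = s.inlExt v := by simp [f]
  rw [← hfu, ← hfv]
  have := reachable_map_of_adj (H := H) f ?_ hr
  · simpa only [H, hfu, hfv] using this
  intro x y hxy
  rw [deleteEdges_adj] at hxy
  by_cases hx : x ∈ s.side <;> by_cases hy : y ∈ s.side
  · simp only [f, hx, hy, dif_pos]
    refine Adj.reachable (deleteEdges_adj.2 ⟨(s.extGraph_inlExt _ _).2 hxy.1, fun h => hxy.2 ?_⟩)
    simpa [inlExt, Subtype.ext_iff] using h
  · exact hcross x hx y hy hxy.1
  · exact (hcross y hy x hx hxy.1.symm).symm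
  · simp [f, hx, hy]

lemma card_extSide [Finite V] : s.side.ncard ≤ Nat.card s.extSide :=
  Nat.card_le_card_of_injective s.inlExt fun u v h => by simpa [inlExt, Subtype.ext_iff] using h

/-- The layers are taken around `n₂, n₃, n₄`; an edge between vertices of degree three lies inside
the part and so is on a cycle. -/
lemma le_numDistinct_extGraph [Finite V] (hc : G.Connected) (hb : ¬ HasBridge G) (h3 : IsCubic G)
    {M : ℕ} (hM : 3 * 4 ^ (M + 1) < s.side.ncard) :
    M ≤ numDistinctCycleEdges s.extGraph := by
  refine le_numDistinctCycleEdges (extGraph_connected hc hb).preconnected ?_ ?_ ?_ ?_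
    (hM.trans_le card_extSide)
  · intro v
    induction v using s.extSide_cases with
    | h u => exact (ncard_neighborSet_inlExt hb h3 u).le
    | h' k hk => exact (s.ncard_neighborSet_newExt k hk).trans (by simp)
  · rw [setOf_ncard_neighborSet_ext_ne hb h3]
    exact ⟨_, .inl rfl⟩
  · rw [setOf_ncard_neighborSet_ext_ne hb h3]
    exact (Set.ncard_insert_le _ _).trans (Nat.succ_le_succ (ncard_pair_le _ _))
  · intro u v huv hu hv
    induction u using s.extSide_cases with
    | h' k hk => have := s.ncard_neighborSet_newExt k hk; omega
    | h u =>
    induction v using s.extSide_cases with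
    | h' k hk => have := s.ncard_neighborSet_newExt k hk; omega
    | h v => exact mem_cycleEdges_inlExt hb ((s.extGraph_inlExt _ _).1 huv)

end Split

end Extension

/-! ### Unbounded growth of the number of distinct cycle edges of `G₁'`. -/

section Growth

variable {V : Type*} {G : SimpleGraph V}

namespace IsTwoCut

variable {S : Set V} {a₁ b₁ a₂ b₂ : V}

/-- If the side `Sᶜ` of a two-edge cut falls into two pieces joined by one edge, both pieces are
again sides of two-edge cuts. -/
lemma exists_isTwoCut_of_mem (h : IsTwoCut G S a₁ b₁ a₂ b₂) {A : Set V} (hAS : A ⊆ Sᶜ) {u v : V}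
    (hu : u ∈ A) (hv : v ∈ Sᶜ \ A) (huv : G.Adj u v)
    (hcr : ∀ x ∈ A, ∀ y ∈ Sᶜ \ A, G.Adj x y → x = u ∧ y = v) (ha₁ : a₁ ∈ A) (ha₂ : a₂ ∉ A) :
    IsTwoCut G A v u b₁ a₁ ∧ IsTwoCut G (Sᶜ \ A) u v b₂ a₂ := by
  have hb₁ := h.b₁_mem
  have hb₂ := h.b₂_mem
  constructor
  · refine ⟨hv.2, hu, fun h' => hAS h' hb₁, ha₁, huv.symm, h.adj₁.symm, ?_, ?_⟩
    · rintro ⟨rfl, -⟩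
      exact hv.1 hb₁
    · intro x hx y hy hxy
      by_cases hyS : y ∈ S
      · rcases h.crossing y hyS x (hAS hx) hxy.symm with ⟨rfl, rfl⟩ | ⟨rfl, rfl⟩
        · exact .inr ⟨rfl, rfl⟩
        · contradiction
      · exact .inl (hcr x hx y ⟨hyS, hy⟩ hxy)
  · refine ⟨fun h' => h'.2 hu, hv, fun h' => h'.1 hb₂, ⟨h.a₂_notMem, ha₂⟩, huv, h.adj₂.symm, ?_, ?_⟩
    · rintro ⟨rfl, -⟩
      exact hAS hu hb₂
    · intro x hx y hy hxy
      by_cases hyS : y ∈ S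
      · rcases h.crossing y hyS x hx.1 hxy.symm with ⟨rfl, rfl⟩ | ⟨rfl, rfl⟩
        · exact (hx.2 ha₁).elim
        · exact .inr ⟨rfl, rfl⟩
      · have hyA : y ∈ A := by
          by_contra hyA
          exact hy ⟨hyS, hyA⟩
        exact .inl (hcr y hyA x hx hxy.symm).symm

/-- The bridge cuts `Sᶜ` into two pieces. If `a₁` and `a₂` lay in the same piece, only the bridge
would leave the other one, making it a bridge of `G`. So each piece is bounded by the bridge and one
cut edge. -/
lemma exists_isTwoCut_of_hasBridge (h : IsTwoCut G S a₁ b₁ a₂ b₂) (hb : ¬ HasBridge G)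
    (hbr : HasBridge (G.induce Sᶜ)) :
    ∃ A ⊆ Sᶜ, (∃ c₁ d₁ c₂ d₂, IsTwoCut G A c₁ d₁ c₂ d₂) ∧
      ∃ c₁ d₁ c₂ d₂, IsTwoCut G (Sᶜ \ A) c₁ d₁ c₂ d₂ := by
  obtain ⟨e, he, hbr⟩ := hbr
  induction e with | h u v
  rw [isBridge_iff] at hbr
  let K := (G.induce Sᶜ).deleteEdges {s(u, v)}
  let A : Set V := {w | ∃ hw : w ∈ Sᶜ, K.Reachable u ⟨w, hw⟩}
  have hAS : A ⊆ Sᶜ := fun w hw => hw.1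
  have hu : u.1 ∈ A := ⟨u.2, .rfl⟩
  have hvA : v.1 ∉ A := fun h' => hbr h'.2
  have huv : G.Adj u v := by simpa using he
  have hcr : ∀ x ∈ A, ∀ y ∈ Sᶜ \ A, G.Adj x y → x = u ∧ y = v := by
    rintro x ⟨hxS, hx⟩ y ⟨hyS, hy⟩ hxy
    by_contra hn
    refine hy ⟨hyS, hx.trans (Adj.reachable (deleteEdges_adj.2 ⟨by simpa using hxy, ?_⟩))⟩
    intro he
    rcases Sym2.eq_iff.1 he with ⟨rfl, rfl⟩ | ⟨rfl, rfl⟩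
    · exact hn ⟨rfl, rfl⟩
    · exact hbr hx
  have hv : v.1 ∈ Sᶜ \ A := ⟨v.2, hvA⟩
  refine ⟨A, hAS, ?_⟩
  by_cases ha₁ : a₁ ∈ A <;> by_cases ha₂ : a₂ ∈ A
  · exfalso
    refine hb (hasBridge_of_unique_crossing (X := Sᶜ \ A) hv (fun h' => h'.2 hu) huv.symm ?_)
    intro x hx y hy hxy
    by_cases hyA : y ∈ A
    · obtain ⟨rfl, rfl⟩ := hcr y hyA x hx hxy.symm
      rfl
    · have hyS : y ∈ S := by
        by_contra hyS
        exact hy ⟨hyS, hyA⟩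
      rcases h.crossing y hyS x hx.1 hxy.symm with ⟨-, rfl⟩ | ⟨-, rfl⟩
      exacts [(hx.2 ha₁).elim, (hx.2 ha₂).elim]
  · obtain ⟨h₁, h₂⟩ := h.exists_isTwoCut_of_mem hAS hu hv huv hcr ha₁ ha₂
    exact ⟨⟨_, _, _, _, h₁⟩, _, _, _, _, h₂⟩
  · obtain ⟨h₁, h₂⟩ := h.swap.exists_isTwoCut_of_mem hAS hu hv huv hcr ha₂ ha₁
    exact ⟨⟨_, _, _, _, h₁⟩, _, _, _, _, h₂⟩
  · exfalso
    refine hb (hasBridge_of_unique_crossing (X := A) hu hvA huv ?_)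
    intro x hx y hy hxy
    by_cases hyS : y ∈ S
    · rcases h.crossing y hyS x (hAS hx) hxy.symm with ⟨-, rfl⟩ | ⟨-, rfl⟩ <;> contradiction
    · obtain ⟨rfl, rfl⟩ := hcr x hx y ⟨hyS, hy⟩ hxy
      rfl

end IsTwoCut

namespace Split

variable (s : Split G)

/-- If the chosen part has less than a third of the vertices, the other part has no bridge, since
a bridge would give a more even bi-bridge. -/
lemma not_hasBridge_compl [Finite V] (hc : G.Connected) (hb : ¬ HasBridge G)
    (hs : 3 * s.side.ncard < Nat.card V) : ¬ HasBridge (G.induce s.sideᶜ) := by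
  intro hbr
  obtain ⟨A, hA, ⟨_, _, _, _, h₁⟩, _, _, _, _, h₂⟩ :=
    s.isTwoCut.exists_isTwoCut_of_hasBridge hb hbr
  have e₁ := s.most_even _ _ _ h₁.isBibridge (h₁.isPart hc hb)
  have e₂ := s.most_even _ _ _ h₂.isBibridge (h₂.isPart hc hb)
  have c₀ := Set.ncard_add_ncard_compl s.side
  have c₁ := Set.ncard_add_ncard_compl A
  have c₂ := Set.ncard_add_ncard_compl (s.sideᶜ \ A)
  have c₃ := Set.ncard_sdiff_add_ncard_of_subset hA
  have p₁ : 0 < A.ncard := (Set.ncard_pos).2 ⟨_, h₁.b₁_mem⟩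
  have p₂ : 0 < (s.sideᶜ \ A).ncard := (Set.ncard_pos).2 ⟨_, h₂.b₁_mem⟩
  -- Evenness leaves each piece at most `|S|` or at least `|Sᶜ|` vertices; the latter fails since
  -- the other piece is nonempty. Hence `|Sᶜ| ≤ 2|S|`, a contradiction.
  unfold imbalance at e₁ e₂
  omega

/-- Here the layers are taken around `a₁` and `a₂`, the only vertices that lose a neighbour; without
bridges every edge is on a cycle. -/
lemma le_numDistinct_compl [Finite V] (hc : G.Connected) (hb : ¬ HasBridge G) (h3 : IsCubic G)
    (hbr : ¬ HasBridge (G.induce s.sideᶜ)) {M : ℕ} (hM : 3 * 4 ^ (M + 1) < s.sideᶜ.ncard) :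
    M ≤ numDistinctCycleEdges (G.induce s.sideᶜ) := by
  have hcut := s.isTwoCut
  have hfin : ∀ v, (G.neighborSet v ∩ s.sideᶜ).ncard ≤ 3 := fun v => by
    rw [← h3 v]
    exact Set.ncard_le_ncard Set.inter_subset_left (Set.toFinite _)
  have hT : {v | ((G.induce s.sideᶜ).neighborSet v).ncard ≠ 3} ⊆
      {⟨s.a₁, s.a₁_notMem⟩, ⟨s.a₂, s.a₂_notMem⟩} := by
    intro v hv
    by_contra hn
    refine hv ?_
    rw [ncard_neighborSet_induce, Set.inter_eq_left.2, h3]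
    intro w hw hws
    simp only [Set.mem_insert_iff, Set.mem_singleton_iff, Subtype.ext_iff, not_or] at hn
    have := hcut.crossing w hws v v.2 (hw : G.Adj v w).symm
    tauto
  refine le_numDistinctCycleEdges (hcut.compl.connected_induce hc hb).preconnected ?_ ?_ ?_ ?_ hM
  · intro v
    rw [ncard_neighborSet_induce]
    exact hfin v
  · refine ⟨⟨s.a₁, s.a₁_notMem⟩, ?_⟩
    rw [Set.mem_ofPred_eq, ncard_neighborSet_induce, ← h3 s.a₁]
    refine (Set.ncard_lt_ncard ⟨Set.inter_subset_left, fun h => ?_⟩ (Set.toFinite _)).ne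
    exact (h hcut.adj₁).2 s.b₁_mem
  · exact (Set.ncard_le_ncard hT (Set.toFinite _)).trans ((ncard_pair_le _ _).trans (by simp))
  · intro u v huv _ _
    exact mem_cycleEdges_of_not_isBridge huv fun h => hbr ⟨_, huv, h⟩

/-- The number of vertices beyond which `G₁'` has `M` pairwise distinct edges on cycles. -/
def growthBound (M : ℕ) : ℕ :=
  -- With `K = 3 * 4 ^ (M + 1)`, the first summand makes a part of at most `K` vertices smaller than
  -- a third; the second leaves its complement enough vertices for `K ^ 2 + 1` classes.
  3 * (3 * 4 ^ (M + 1) + 1) + 3 * 4 ^ ((3 * 4 ^ (M + 1)) ^ 2 + 2) + 1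

/-- A part of at most `K` vertices has at most `K ^ 2` classes, while its bridgeless complement
would have `K ^ 2 + 1`, contradicting `more_distinct`. So the chosen part is large. -/
theorem le_numDistinctCycleEdges_extGraph [Finite V] (hc : G.Connected) (hb : ¬ HasBridge G)
    (h3 : IsCubic G) {M : ℕ} (hM : growthBound M ≤ Nat.card V) :
    M ≤ numDistinctCycleEdges s.extGraph := by
  by_cases hlt : 3 * 4 ^ (M + 1) < s.side.ncard
  · exact le_numDistinct_extGraph hc hb h3 hlt
  exfalso
  unfold growthBound at hM
  set K := 3 * 4 ^ (M + 1)
  have c₀ := Set.ncard_add_ncard_compl s.side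
  have hbr := s.not_hasBridge_compl hc hb (by omega)
  have h₁ : K ^ 2 + 1 ≤ _ := s.le_numDistinct_compl hc hb h3 hbr (M := K ^ 2 + 1) (by
    change 3 * 4 ^ (K ^ 2 + 2) < _
    generalize 4 ^ (K ^ 2 + 2) = x at hM ⊢
    omega)
  have h₂ : _ ≤ s.side.ncard ^ 2 := numDistinctCycleEdges_le (H := G.induce s.side)
  have h₃ : s.side.ncard ^ 2 ≤ K ^ 2 := Nat.pow_le_pow_left (by omega) 2
  have h₄ := s.more_distinct
  omega

end Split

end Growth

/-! ### Structure of the outputs and of the isomorphisms between them. -/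

section Output

variable {V V' : Type*} {G : SimpleGraph V} {G' : SimpleGraph V'}

/-- `H` arises from `G` by the construction, using the cut `a₁b₁, a₂b₂` around `S` and the
edge `xy` inside `S`. -/
structure IsOutput (G : SimpleGraph V) (H : SimpleGraph (V ⊕ Fin 4)) (S : Set V)
    (a₁ b₁ a₂ b₂ x y : V) : Prop where
  cut : IsTwoCut G S a₁ b₁ a₂ b₂
  a_ne : a₁ ≠ a₂
  b_ne : b₁ ≠ b₂
  x_mem : x ∈ S
  y_mem : y ∈ S
  adj : G.Adj x y
  x_ne : x ≠ b₁
  y_ne : y ≠ b₂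
  inl_inl : ∀ u v, H.Adj (.inl u) (.inl v) ↔
    G.Adj u v ∧ s(u, v) ≠ s(a₁, b₁) ∧ s(u, v) ≠ s(a₂, b₂) ∧ s(u, v) ≠ s(x, y)
  inl_inr : ∀ u (k : Fin 4), H.Adj (.inl u) (.inr k) ↔
    (u = a₁ ∧ k = 0) ∨ (u = a₂ ∧ k = 0) ∨ (u = b₁ ∧ k = 2) ∨ (u = b₂ ∧ k = 3) ∨
      (u = x ∧ k = 2) ∨ (u = y ∧ k = 3)
  inr_inr : ∀ j k : Fin 4, H.Adj (.inr j) (.inr k) ↔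
    (j = 0 ∧ k = 1) ∨ (j = 1 ∧ k = 0) ∨ (j = 1 ∧ k = 2) ∨ (j = 2 ∧ k = 1) ∨ (j = 1 ∧ k = 3) ∨
      (j = 3 ∧ k = 1)

namespace IsOutput

variable {H : SimpleGraph (V ⊕ Fin 4)} {S : Set V} {a₁ b₁ a₂ b₂ x y : V}

lemma inr_inl (h : IsOutput G H S a₁ b₁ a₂ b₂ x y) (u : V) (k : Fin 4) :
    H.Adj (.inr k) (.inl u) ↔
    (u = a₁ ∧ k = 0) ∨ (u = a₂ ∧ k = 0) ∨ (u = b₁ ∧ k = 2) ∨ (u = b₂ ∧ k = 3) ∨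
      (u = x ∧ k = 2) ∨ (u = y ∧ k = 3) := by
  rw [adj_comm, h.inl_inr]

/-- Each lost neighbour is traded for a new vertex: `n₁` at `a₁, a₂`, `n₃` at `b₁, x`, `n₄` at `b₂,
y`. The trades do not collide because `a₁ ≠ a₂`, `x ≠ b₁` and `y ≠ b₂`. -/
lemma ncard_neighborSet_inl (h : IsOutput G H S a₁ b₁ a₂ b₂ x y) (v : V) :
    (H.neighborSet (.inl v)).ncard = (G.neighborSet v).ncard := by
  classical
  have ha₁ := h.cut.a₁_notMem
  have ha₂ := h.cut.a₂_notMem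
  have hb₁ := h.cut.b₁_mem
  have hb₂ := h.cut.b₂_mem
  have hx := h.x_mem
  have hy := h.y_mem
  have hxy := h.adj.ne
  have hab := h.a_ne
  have hbb := h.b_ne
  have hxb := h.x_ne
  have hyb := h.y_ne
  have ne_a : ∀ {u}, u ∈ S → u ≠ a₁ ∧ u ≠ a₂ := fun hu =>
    ⟨ne_of_mem_of_not_mem hu ha₁, ne_of_mem_of_not_mem hu ha₂⟩
  let ρ : V → V ⊕ Fin 4 := fun w =>
    if (v = a₁ ∧ w = b₁) ∨ (v = a₂ ∧ w = b₂) then .inr 0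
    else if (v = b₁ ∧ w = a₁) ∨ (v = x ∧ w = y) then .inr 2
    else if (v = b₂ ∧ w = a₂) ∨ (v = y ∧ w = x) then .inr 3 else .inl w
  have hinj : Function.Injective ρ := by
    intro w w' hw
    simp only [ρ] at hw
    split_ifs at hw with p₁ q₁ q₂ q₃ p₂ q₁ q₂ q₃ p₃ q₁ q₂ q₃ q₁ q₂ q₃
    all_goals first
      | exact Sum.inl_injective hw
      | exact absurd (Sum.inr_injective hw) (by decide)
      | skip
    · rcases p₁ with p | p <;> rcases q₁ with q | q
      exacts [p.2.trans q.2.symm, (hab (p.1.symm.trans q.1)).elim,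
        (hab (q.1.symm.trans p.1)).elim, p.2.trans q.2.symm]
    · rcases p₂ with p | p <;> rcases q₂ with q | q
      exacts [p.2.trans q.2.symm, (hxb (q.1.symm.trans p.1)).elim,
        (hxb (p.1.symm.trans q.1)).elim, p.2.trans q.2.symm]
    · rcases p₃ with p | p <;> rcases q₃ with q | q
      exacts [p.2.trans q.2.symm, (hyb (q.1.symm.trans p.1)).elim,
        (hyb (p.1.symm.trans q.1)).elim, p.2.trans q.2.symm]
  rw [← Set.ncard_image_of_injective _ hinj]
  congr 1
  ext w
  simp only [mem_neighborSet, Set.mem_image]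
  constructor
  · intro hw
    obtain w | k := w
    · rw [h.inl_inl] at hw
      refine ⟨w, hw.1, ?_⟩
      obtain ⟨-, h₁, h₂, h₃⟩ := hw
      simp only [ne_eq, Sym2.eq_iff, not_or, not_and] at h₁ h₂ h₃
      simp only [ρ]
      rw [if_neg, if_neg, if_neg] <;> tauto
    · have adj₁ := h.cut.adj₁
      have adj₂ := h.cut.adj₂
      have adj₃ := h.adj
      rw [h.inl_inr] at hw
      rcases hw with ⟨rfl, rfl⟩ | ⟨rfl, rfl⟩ | ⟨rfl, rfl⟩ | ⟨rfl, rfl⟩ | ⟨rfl, rfl⟩ | ⟨rfl, rfl⟩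
      · exact ⟨_, adj₁, if_pos (.inl ⟨rfl, rfl⟩)⟩
      · exact ⟨_, adj₂, if_pos (.inr ⟨rfl, rfl⟩)⟩
      · exact ⟨_, adj₁.symm, by simp [ρ, ne_a hb₁]⟩
      · exact ⟨_, adj₂.symm, by simp [ρ, ne_a hb₂, hbb.symm, (ne_a hy).2.symm]⟩
      · exact ⟨_, adj₃, by simp [ρ, ne_a hx]⟩
      · exact ⟨_, adj₃.symm, by simp [ρ, ne_a hy, (ne_a hx).1, hxy.symm]⟩
  · rintro ⟨w, hw, rfl⟩
    simp only [ρ]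
    split_ifs with h₁ h₂ h₃
    · rw [h.inl_inr]
      exact h₁.imp (fun e => ⟨e.1, rfl⟩) fun e => .inl ⟨e.1, rfl⟩
    · rw [h.inl_inr]
      rcases h₂ with e | e <;> simp [e.1]
    · rw [h.inl_inr]
      rcases h₃ with e | e <;> simp [e.1]
    · rw [h.inl_inl]
      refine ⟨hw, ?_, ?_, ?_⟩ <;> intro he <;> rcases Sym2.eq_iff.1 he with e | e
      exacts [h₁ (.inl e), h₂ (.inl e), h₁ (.inr e), h₃ (.inl e), h₂ (.inr e), h₃ (.inr e)]

lemma isCubic (h : IsOutput G H S a₁ b₁ a₂ b₂ x y) (h3 : IsCubic G) : IsCubic H := by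
  have key : ∀ k (p q r : V ⊕ Fin 4), p ≠ q → p ≠ r → q ≠ r →
      (∀ w, H.Adj (.inr k) w ↔ w = p ∨ w = q ∨ w = r) → (H.neighborSet (.inr k)).ncard = 3 :=
    fun k p q r hpq hpr hqr hw => Set.ncard_eq_three.2
      ⟨p, q, r, hpq, hpr, hqr, by ext w; simpa using hw w⟩
  rintro (v | k)
  · rw [h.ncard_neighborSet_inl, h3]
  · fin_cases k
    · refine key _ (.inl a₁) (.inl a₂) (.inr 1) (by simpa using h.a_ne) (by simp) (by simp) ?_
      rintro (w | k) <;> simp [h.inr_inl, h.inr_inr]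
    · refine key _ (.inr 0) (.inr 2) (.inr 3) (by simp) (by simp) (by simp) ?_
      rintro (w | k) <;> simp [h.inr_inl, h.inr_inr]
    · refine key _ (.inl b₁) (.inl x) (.inr 1) (by simpa using h.x_ne.symm) (by simp) (by simp) ?_
      rintro (w | k) <;> simp [h.inr_inl, h.inr_inr]
    · refine key _ (.inl b₂) (.inl y) (.inr 1) (by simpa using h.y_ne.symm) (by simp) (by simp) ?_
      rintro (w | k) <;> simp [h.inr_inl, h.inr_inr]

/-- Every edge of `G` that is missing in `H` is replaced by a path through the new vertices. -/
lemma reachable_of_adj (h : IsOutput G H S a₁ b₁ a₂ b₂ x y) {K : SimpleGraph (V ⊕ Fin 4)}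
    (h₁ : ∀ u k, H.Adj (.inl u) (.inr k) → K.Adj (.inl u) (.inr k))
    (h₂ : ∀ j k, H.Adj (.inr j) (.inr k) → K.Adj (.inr j) (.inr k)) {p q : V} (hpq : G.Adj p q)
    (h₃ : H.Adj (.inl p) (.inl q) → K.Adj (.inl p) (.inl q)) :
    K.Reachable (.inl p) (.inl q) := by
  have r₁ : ∀ u k, H.Adj (.inl u) (.inr k) → K.Reachable (.inl u) (.inr k) :=
    fun u k hu => (h₁ u k hu).reachable
  have r₂ : ∀ j k, H.Adj (.inr j) (.inr k) → K.Reachable (.inr j) (.inr k) :=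
    fun u k hu => (h₂ u k hu).reachable
  -- The new vertices form a star centred at `n₂`, which `K` retains.
  have n : ∀ k, K.Reachable (.inr k) (.inr 1) := by
    intro k
    by_cases hk : k = 1
    · rw [hk]
    · exact r₂ _ _ ((h.inr_inr _ _).2 (by omega))
  have aux : ∀ u v j k, H.Adj (.inl u) (.inr j) → H.Adj (.inl v) (.inr k) →
      K.Reachable (.inl u) (.inl v) := fun u v j k hu hv =>
    (r₁ _ _ hu).trans ((n j).trans ((n k).symm.trans (r₁ _ _ hv).symm))
  have e₁ : K.Reachable (.inl a₁) (.inl b₁) :=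
    aux _ _ 0 2 (by simp [h.inl_inr]) (by simp [h.inl_inr])
  have e₂ : K.Reachable (.inl a₂) (.inl b₂) :=
    aux _ _ 0 3 (by simp [h.inl_inr]) (by simp [h.inl_inr])
  have e₃ : K.Reachable (.inl x) (.inl y) :=
    aux _ _ 2 3 (by simp [h.inl_inr]) (by simp [h.inl_inr])
  by_cases hH : H.Adj (.inl p) (.inl q)
  · exact (h₃ hH).reachable
  · rw [h.inl_inl] at hH
    have : s(p, q) = s(a₁, b₁) ∨ s(p, q) = s(a₂, b₂) ∨ s(p, q) = s(x, y) := by tauto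
    rcases this with he | he | he <;> rcases Sym2.eq_iff.1 he with ⟨rfl, rfl⟩ | ⟨rfl, rfl⟩
    exacts [e₁, e₁.symm, e₂, e₂.symm, e₃, e₃.symm]

lemma connected (h : IsOutput G H S a₁ b₁ a₂ b₂ x y) (hc : G.Connected) : H.Connected := by
  have hinl : ∀ u v, H.Reachable (.inl u) (.inl v) := fun u v =>
    reachable_map_of_adj (G := G) Sum.inl (fun p q hpq =>
      h.reachable_of_adj (fun _ _ => id) (fun _ _ => id) hpq id) (hc.preconnected u v)
  refine (connected_iff_exists_forall_reachable _).2 ⟨.inl a₁, ?_⟩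
  have h₀ : H.Reachable (.inl a₁) (.inr 0) := Adj.reachable (by simp [h.inl_inr])
  have h₁ : H.Reachable (.inr 0) (.inr 1) := Adj.reachable (by simp [h.inr_inr])
  rintro (v | k)
  · exact hinl _ _
  · have hk : k = 0 ∨ k = 1 ∨ k = 2 ∨ k = 3 := by omega
    rcases hk with rfl | rfl | hk
    · exact h₀
    · exact h₀.trans h₁
    · exact (h₀.trans h₁).trans (Adj.reachable (by rw [h.inr_inr]; omega))

/-- No other edge leaves `Sᶜ ∪ {n₁}`, since both cut edges are gone and `x, y` lie in `S`. -/
lemma isBridge (h : IsOutput G H S a₁ b₁ a₂ b₂ x y) : H.IsBridge s(.inr 0, .inr 1) := by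
  have ha₁ := h.cut.a₁_notMem
  have ha₂ := h.cut.a₂_notMem
  have hb₁ := h.cut.b₁_mem
  have hb₂ := h.cut.b₂_mem
  have hx := h.x_mem
  have hy := h.y_mem
  refine isBridge_of_unique_crossing (X := Sum.inl '' Sᶜ ∪ {.inr 0}) (by simp) (by simp) ?_
  rintro (u | j) hu (v | k) hv huv
  · have hu' : u ∉ S := by simpa using hu
    have hv' : v ∈ S := by simpa using hv
    rw [h.inl_inl] at huv
    rcases h.cut.crossing v hv' u hu' huv.1.symm with ⟨rfl, rfl⟩ | ⟨rfl, rfl⟩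
    · exact (huv.2.1 rfl).elim
    · exact (huv.2.2.1 rfl).elim
  · have hu' : u ∉ S := by simpa using hu
    have hk : k ≠ 0 := by simpa using hv
    rw [h.inl_inr] at huv
    rcases huv with ⟨rfl, rfl⟩ | ⟨rfl, rfl⟩ | ⟨rfl, rfl⟩ | ⟨rfl, rfl⟩ | ⟨rfl, rfl⟩ | ⟨rfl, rfl⟩ <;>
      contradiction
  · have hj : j = 0 := by simpa using hu
    have hv' : v ∈ S := by simpa using hv
    subst hj
    rw [h.inr_inl] at huv
    rcases huv with ⟨rfl, h'⟩ | ⟨rfl, h'⟩ | ⟨rfl, h'⟩ | ⟨rfl, h'⟩ | ⟨rfl, h'⟩ | ⟨rfl, h'⟩ <;>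
      contradiction
  · have hj : j = 0 := by simpa using hu
    have hk : k ≠ 0 := by simpa using hv
    subst hj
    rw [h.inr_inr] at huv
    have : k = 1 := by omega
    rw [this]

lemma hasBridge (h : IsOutput G H S a₁ b₁ a₂ b₂ x y) : HasBridge H :=
  ⟨_, (h.inr_inr 0 1).2 (by simp), h.isBridge⟩

/-- Every bridge of `H` contains a new vertex. -/
lemma exists_inr_mem (h : IsOutput G H S a₁ b₁ a₂ b₂ x y) (hb : ¬ HasBridge G)
    {e : Sym2 (V ⊕ Fin 4)} (he : e ∈ H.edgeSet) (hbr : H.IsBridge e) : ∃ k, .inr k ∈ e := by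
  induction e with | h u v
  obtain u | k := u
  swap
  · exact ⟨k, Sym2.mem_mk_left _ _⟩
  obtain v | k := v
  swap
  · exact ⟨k, Sym2.mem_mk_right _ _⟩
  exfalso
  have huv : G.Adj u v := ((h.inl_inl u v).1 he).1
  have hr : (G.deleteEdges {s(u, v)}).Reachable u v := by
    by_contra hn
    exact hb ⟨s(u, v), huv, hn⟩
  -- A detour around `uv` in `G` lifts to `H` without using `uv`.
  refine hbr (reachable_map_of_adj Sum.inl (fun p q hpq => ?_) hr)
  rw [deleteEdges_adj] at hpq
  refine h.reachable_of_adj (fun u k h' => deleteEdges_adj.2 ⟨h', by simp⟩)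
    (fun j k h' => deleteEdges_adj.2 ⟨h', by simp⟩) hpq.1
    fun h' => deleteEdges_adj.2 ⟨h', fun he => hpq.2 ?_⟩
  simpa using he

/-- The labels from which `G`, the cut and the edge `xy` can be recovered. -/
def labels (a₁ b₁ a₂ b₂ x y : V) : Fin 10 → V ⊕ Fin 4 :=
  ![.inr 0, .inr 1, .inr 2, .inr 3, .inl a₁, .inl b₁, .inl a₂, .inl b₂, .inl x, .inl y]

/-- Isomorphisms between outputs can only move the labels within a small ball. -/
lemma apply_labels_mem {G' : SimpleGraph V} {H' : SimpleGraph (V ⊕ Fin 4)} {S' : Set V}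
    {a₁' b₁' a₂' b₂' x' y' : V} (h : IsOutput G H S a₁ b₁ a₂ b₂ x y)
    (h' : IsOutput G' H' S' a₁' b₁' a₂' b₂' x' y') (hb' : ¬ HasBridge G')
    (φ : H ≃g H') (k : Fin 10) :
    φ (labels a₁ b₁ a₂ b₂ x y k) ∈ setBall H' (Set.range Sum.inr) 3 := by
  have hadj : H.Adj (.inr 0) (.inr 1) := (h.inr_inr 0 1).2 (by simp)
  have hbr : H'.IsBridge s(φ (.inr 0), φ (.inr 1)) := by
    rw [isBridge_iff]
    intro hr
    refine h.isBridge ?_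
    have hr' := reachable_map_of_adj (H := H.deleteEdges {s(.inr 0, .inr 1)}) φ.symm
      (fun u v huv => ?_) hr
    · simpa using hr'
    · rw [deleteEdges_adj] at huv
      refine Adj.reachable (deleteEdges_adj.2 ⟨φ.symm.map_adj_iff.2 huv.1, fun he => huv.2 ?_⟩)
      have := congrArg (Sym2.map φ) (show s(φ.symm u, φ.symm v) = s(.inr 0, .inr 1) from he)
      simpa using this
  -- The image of `n₁n₂` is a bridge, so it meets a new vertex: `n₁, n₂` land within distance 1,
  -- `n₃, n₄` within 2, and their neighbours within 3.
  obtain ⟨j, hj⟩ := h'.exists_inr_mem hb' (φ.map_adj_iff.2 hadj) hbr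
  have step : ∀ {u v : V ⊕ Fin 4} (k : ℕ), φ u ∈ setBall H' (Set.range Sum.inr) k → H.Adj u v →
      φ v ∈ setBall H' (Set.range Sum.inr) (k + 1) := fun k hu huv =>
    mem_setBall_succ_of_adj hu (φ.map_adj_iff.2 huv)
  have mono : ∀ {u : V ⊕ Fin 4} (k : ℕ), φ u ∈ setBall H' (Set.range Sum.inr) k →
      φ u ∈ setBall H' (Set.range Sum.inr) (k + 1) := fun k hu => setBall_subset_succ _ _ hu
  have h01 : φ (.inr 0) ∈ setBall H' (Set.range Sum.inr) 1 ∧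
      φ (.inr 1) ∈ setBall H' (Set.range Sum.inr) 1 := by
    rcases Sym2.mem_iff.1 hj with hj | hj
    · have : φ (.inr 0) ∈ setBall H' (Set.range Sum.inr) 0 := ⟨j, hj⟩
      exact ⟨mono _ this, step _ this hadj⟩
    · have : φ (.inr 1) ∈ setBall H' (Set.range Sum.inr) 0 := ⟨j, hj⟩
      exact ⟨step _ this hadj.symm, mono _ this⟩
  obtain ⟨h0, h1⟩ := h01
  have h2 : φ (.inr 2) ∈ setBall H' (Set.range Sum.inr) 2 :=
    step _ h1 ((h.inr_inr _ _).2 (by simp))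
  have h3 : φ (.inr 3) ∈ setBall H' (Set.range Sum.inr) 2 :=
    step _ h1 ((h.inr_inr _ _).2 (by simp))
  fin_cases k
  · exact mono _ (mono _ h0)
  · exact mono _ (mono _ h1)
  · exact mono _ h2
  · exact mono _ h3
  · exact mono _ (step _ h0 ((h.inr_inl _ _).2 (by simp)))
  · exact step _ h2 ((h.inr_inl _ _).2 (by simp))
  · exact mono _ (step _ h0 ((h.inr_inl _ _).2 (by simp)))
  · exact step _ h3 ((h.inr_inl _ _).2 (by simp))
  · exact step _ h2 ((h.inr_inl _ _).2 (by simp))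
  · exact step _ h3 ((h.inr_inl _ _).2 (by simp))

/-- An isomorphism of outputs that respects the labels comes from an isomorphism of the original
graphs. -/
lemma exists_iso {H' : SimpleGraph (V' ⊕ Fin 4)} {S' : Set V'} {a₁' b₁' a₂' b₂' x' y' : V'}
    (h : IsOutput G H S a₁ b₁ a₂ b₂ x y) (h' : IsOutput G' H' S' a₁' b₁' a₂' b₂' x' y')
    (ψ : H ≃g H')
    (hψ : ∀ k, ψ (labels a₁ b₁ a₂ b₂ x y k) = labels a₁' b₁' a₂' b₂' x' y' k) :
    ∃ σ : G ≃g G', σ a₁ = a₁' ∧ σ b₁ = b₁' ∧ σ a₂ = a₂' ∧ σ b₂ = b₂' ∧ σ x = x' ∧ σ y = y' := by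
  have hn : ∀ k : Fin 4, ψ (.inr k) = .inr k := by
    intro k
    fin_cases k
    exacts [hψ 0, hψ 1, hψ 2, hψ 3]
  have hex : ∀ v, ∃ w, ψ (.inl v) = .inl w := by
    intro v
    rcases hv : ψ (.inl v) with w | k
    · exact ⟨w, rfl⟩
    · rw [← hn k] at hv
      simpa using ψ.injective hv
  have hex' : ∀ v, ∃ w, ψ.symm (.inl v) = .inl w := by
    intro v
    rcases hv : ψ.symm (.inl v) with w | k
    · exact ⟨w, rfl⟩
    · have := congrArg ψ hv
      rw [hn k] at this
      simp at this
  choose σ hσ using hex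
  choose τ hτ using hex'
  have hστ : ∀ v, σ (τ v) = v := fun v => by
    have : ψ (ψ.symm (.inl v)) = .inl v := by simp
    rw [hτ, hσ] at this
    simpa using this
  have hτσ : ∀ v, τ (σ v) = v := fun v => by
    have : ψ.symm (ψ (.inl v)) = .inl v := by simp
    rw [hσ, hτ] at this
    simpa using this
  have lab : ∀ {v w}, ψ (.inl v) = .inl w → σ v = w := fun {v w} hv => by
    rw [hσ] at hv
    simpa using hv
  have l₁ : σ a₁ = a₁' := lab (hψ 4)
  have l₂ : σ b₁ = b₁' := lab (hψ 5)
  have l₃ : σ a₂ = a₂' := lab (hψ 6)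
  have l₄ : σ b₂ = b₂' := lab (hψ 7)
  have l₅ : σ x = x' := lab (hψ 8)
  have l₆ : σ y = y' := lab (hψ 9)
  let e : V ≃ V' := ⟨σ, τ, hτσ, hστ⟩
  have hsym : ∀ u v p q, s(σ u, σ v) = s(σ p, σ q) ↔ s(u, v) = s(p, q) := fun u v p q => by
    rw [← Sym2.map_mk, ← Sym2.map_mk]
    exact (Sym2.map.injective e.injective).eq_iff
  refine ⟨⟨e, fun {u v} => ?_⟩, l₁, l₂, l₃, l₄, l₅, l₆⟩
  change G'.Adj (σ u) (σ v) ↔ G.Adj u v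
  have hH : H'.Adj (.inl (σ u)) (.inl (σ v)) ↔ H.Adj (.inl u) (.inl v) := by
    rw [← hσ, ← hσ, ψ.map_adj_iff]
  rw [h.inl_inl, h'.inl_inl, ← l₁, ← l₂, ← l₃, ← l₄, ← l₅, ← l₆, Ne, hsym, Ne, hsym, Ne, hsym] at hH
  -- `H` does not show the three deleted edges, but their ends are labelled and so are matched by
  -- `σ`.
  have aux : ∀ {p q}, G.Adj p q → G'.Adj (σ p) (σ q) → s(u, v) = s(p, q) →
      (G'.Adj (σ u) (σ v) ↔ G.Adj u v) := by
    intro p q hpq hpq' he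
    rcases Sym2.eq_iff.1 he with ⟨rfl, rfl⟩ | ⟨rfl, rfl⟩
    · exact iff_of_true hpq' hpq
    · exact iff_of_true hpq'.symm hpq.symm
  by_cases e₁ : s(u, v) = s(a₁, b₁)
  · exact aux h.cut.adj₁ (by rw [l₁, l₂]; exact h'.cut.adj₁) e₁
  by_cases e₂ : s(u, v) = s(a₂, b₂)
  · exact aux h.cut.adj₂ (by rw [l₃, l₄]; exact h'.cut.adj₂) e₂
  by_cases e₃ : s(u, v) = s(x, y)
  · exact aux h.adj (by rw [l₅, l₆]; exact h'.adj) e₃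
  tauto

end IsOutput

end Output

/-! ### Candidate edges, admissible orders and complete runs. -/

section Construction

variable {V : Type*} {G : SimpleGraph V}

lemma cycleEdges_subset_edgeSet {W : Type*} (H : SimpleGraph W) : cycleEdges H ⊆ H.edgeSet := by
  rintro e ⟨u, p, -, he⟩
  exact p.edges_subset_edgeSet he

namespace Split

variable (s : Split G)

/-- Within `G₁'` the only neighbours of `n₂` are `n₃` and `n₄`, so a candidate edge avoids `n₂` as
well. -/
lemma eq_of_extGraph_adj_newExt {v : s.extSide} (h₂ : v.1 ≠ .inr 2) (h₃ : v.1 ≠ .inr 3)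
    {k : Fin 4} (hk : k ≠ 0) (h : s.extGraph.Adj (s.newExt k hk) v) : k = 2 ∨ k = 3 := by
  rw [extGraph_adj] at h
  obtain ⟨v | j, hv⟩ := v
  · simp only [newExt, splitGraph_inr_inl] at h
    omega
  · simp only [newExt, splitGraph_inr_inr] at h
    have h₄ : j ≠ 2 := fun h' => h₂ (congrArg Sum.inr h')
    have h₅ : j ≠ 3 := fun h' => h₃ (congrArg Sum.inr h')
    have h₆ : j ≠ 0 := by simpa using hv
    omega

/-- The candidate edges are edges inside the chosen part. -/
lemma exists_inlExt_of_candidate {u v : s.extSide} (h : s(u, v) ∈ s.candidateEdges) :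
    ∃ x y : s.side, u = s.inlExt x ∧ v = s.inlExt y ∧ G.Adj x y := by
  have hadj : s.extGraph.Adj u v := cycleEdges_subset_edgeSet _ h.1
  have hu := h.2 u (Sym2.mem_mk_left _ _)
  have hv := h.2 v (Sym2.mem_mk_right _ _)
  induction u using s.extSide_cases with
  | h' k hk =>
    exfalso
    rcases s.eq_of_extGraph_adj_newExt hv.1 hv.2 hk hadj with rfl | rfl
    exacts [hu.1 rfl, hu.2 rfl]
  | h x =>
  induction v using s.extSide_cases with
  | h' k hk =>
    exfalso
    rcases s.eq_of_extGraph_adj_newExt hu.1 hu.2 hk hadj.symm with rfl | rfl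
    exacts [hv.1 rfl, hv.2 rfl]
  | h y => exact ⟨x, y, rfl, rfl, (s.extGraph_inlExt x y).1 hadj⟩

/-- Every candidate edge has an admissible order of its ends. -/
lemma exists_admissible (hb : ¬ HasBridge G) (h3 : IsCubic G) {e : Sym2 s.extSide}
    (he : e ∈ s.candidateEdges) : ∃ d, s.Admissible d ∧ d.edge = e := by
  have hbb := s.isTwoCut.b_ne hb h3
  induction e with | h u v
  have hadj : s.extGraph.Adj u v := cycleEdges_subset_edgeSet _ he.1
  obtain ⟨x, y, rfl, rfl, hxy⟩ := s.exists_inlExt_of_candidate he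
  -- Failure of both orders would force `x = y` or `b₁ = b₂`.
  by_cases h : x.1 = s.b₁ ∨ y.1 = s.b₂
  · refine ⟨⟨(_, _), hadj.symm⟩, ⟨?_, ?_, ?_⟩, Sym2.eq_swap⟩
    · have he' : s(s.inlExt y, s.inlExt x) ∈ s.candidateEdges := by
        rw [Sym2.eq_swap]
        exact he
      exact he'
    all_goals
      have := hxy.ne
      simp only [splitGraph_inl_inr]
      grind
  · rw [not_or] at h
    exact ⟨⟨(_, _), hadj⟩, ⟨he, by simp [h.1], by simp [h.2]⟩, rfl⟩

/-- The construction can be completed from every split. -/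
lemma exists_run (s : Split G) (hb : ¬ HasBridge G) (h3 : IsCubic G) : Nonempty (Run G) := by
  let r : Setoid s.candidateEdges :=
    ⟨fun e f => Similar s.extGraph e f, fun e => similar_refl e.1, Similar.symm, Similar.trans⟩
  have hd : ∀ q : Quotient r, ∃ d, s.Admissible d ∧ d.edge = q.out.1 := fun q =>
    s.exists_admissible hb h3 q.out.2
  choose d hd hde using hd
  refine ⟨⟨s, Set.range d, ?_, ?_⟩⟩
  · rintro _ ⟨q, rfl⟩
    exact hd q
  · intro e he
    refine ⟨d ⟦⟨e, he⟩⟧, ⟨⟨_, rfl⟩, ?_⟩, ?_⟩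
    · rw [hde]
      exact Setoid.symm (Quotient.mk_out (s := r) ⟨e, he⟩)
    · rintro _ ⟨⟨q, rfl⟩, hq⟩
      congr 1
      rw [← q.out_eq]
      rw [hde] at hq
      exact (Quotient.sound (s := r) (a := ⟨e, he⟩) (b := q.out) hq).symm

lemma isOutput (hb : ¬ HasBridge G) (h3 : IsCubic G) {d : s.extGraph.Dart}
    (hd : s.Admissible d) : ∃ x y : s.side, d.fst = s.inlExt x ∧ d.snd = s.inlExt y ∧
      IsOutput G (s.insertion d) s.side s.a₁ s.b₁ s.a₂ s.b₂ x y := by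
  obtain ⟨x, y, hx, hy, hxy⟩ := s.exists_inlExt_of_candidate (u := d.fst) (v := d.snd) hd.mem
  have h₁ := hd.fst_not_adj
  have h₂ := hd.snd_not_adj
  refine ⟨x, y, hx, hy, s.isTwoCut, s.isTwoCut.a_ne hb h3, s.isTwoCut.b_ne hb h3, x.2, y.2, hxy,
    ?_, ?_, ?_, ?_, ?_⟩
  · simpa [hx, inlExt] using h₁
  · simpa [hy, inlExt] using h₂
  · intro u v
    simp [insertion, hx, hy, inlExt, and_assoc]
  · intro u k
    simp [insertion, hx, hy, inlExt]
    tauto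
  · intro j k
    simp [insertion, hx, hy, inlExt]

/-- An automorphism of `G` that respects the cut extends to `G₁'`. -/
lemma exists_extGraph_iso (hc : G.Connected) (hb : ¬ HasBridge G) (σ : G ≃g G)
    (ha₁ : σ s.a₁ = s.a₁) (hb₁ : σ s.b₁ = s.b₁) (ha₂ : σ s.a₂ = s.a₂) (hb₂ : σ s.b₂ = s.b₂) :
    ∃ φ : s.extGraph ≃g s.extGraph, ∀ x y : s.side, σ x = y → φ (s.inlExt x) = s.inlExt y := by
  -- The side is connected and contains the fixed vertex `b₁`. If its image left the side, it would
  -- contain `a₁` or `a₂`, whose preimages `a₁`, `a₂` are not in the side.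
  have key : ∀ τ : G ≃g G, τ s.a₁ = s.a₁ → τ s.b₁ = s.b₁ → τ s.a₂ = s.a₂ →
      ∀ v ∈ s.side, τ v ∈ s.side := by
    intro τ h₁ h₂ h₃ v hv
    by_contra hn
    obtain ⟨x, hx, y, hy, hxy⟩ := exists_crossing_edge
      ((s.isTwoCut.connected_induce hc hb).preconnected ⟨s.b₁, s.b₁_mem⟩ ⟨v, hv⟩)
      (X := {w | τ w ∈ s.side}) (by simpa [h₂] using s.b₁_mem) hn
    have hxy' : G.Adj (τ x) (τ y) := τ.map_adj_iff.2 (by simpa using hxy)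
    rcases s.isTwoCut.crossing _ hx _ hy hxy' with ⟨-, h'⟩ | ⟨-, h'⟩
    · rw [← h₁] at h'
      exact s.a₁_notMem (τ.injective h' ▸ y.2)
    · rw [← h₃] at h'
      exact s.a₂_notMem (τ.injective h' ▸ y.2)
  have hside : ∀ v, v ∈ s.side ↔ σ v ∈ s.side := by
    refine fun v => ⟨key σ ha₁ hb₁ ha₂ v, fun hv => ?_⟩
    simpa using key σ.symm (by simp [RelIso.symm_apply_eq, ha₁])
      (by simp [RelIso.symm_apply_eq, hb₁]) (by simp [RelIso.symm_apply_eq, ha₂]) _ hv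
  let e : V ⊕ Fin 4 ≃ V ⊕ Fin 4 := σ.toEquiv.sumCongr (Equiv.refl _)
  have he : ∀ v, v ∈ s.extSide ↔ e v ∈ s.extSide := by
    rintro (v | k)
    · simpa [e] using hside v
    · simp [e]
  have hfix : ∀ {p v}, σ p = p → (σ v = p ↔ v = p) := fun {p v} hp => by
    rw [← σ.injective.eq_iff (a := v), hp]
  refine ⟨⟨e.subtypeEquiv he, fun {u v} => ?_⟩, ?_⟩
  · change s.splitGraph.Adj (e u.1) (e v.1) ↔ s.splitGraph.Adj u.1 v.1
    obtain ⟨u | k, hu⟩ := u <;> obtain ⟨v | j, hv⟩ := v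
    · have hu' : u ∈ s.side := by simpa using hu
      have hv' : v ∈ s.side := by simpa using hv
      simp only [e, Equiv.sumCongr_apply, Sum.map_inl, splitGraph_inl_inl]
      rw [and_iff_left (s.ne_edge_of_mem hu' hv')]
      exact (and_iff_left (s.ne_edge_of_mem ((hside u).1 hu') ((hside v).1 hv'))).trans
        σ.map_adj_iff
    · simp [e, hfix ha₁, hfix hb₁, hfix ha₂, hfix hb₂]
    · simp [e, hfix ha₁, hfix hb₁, hfix ha₂, hfix hb₂]
    · simp [e]
  · rintro x y hxy
    exact Subtype.ext (congrArg Sum.inl hxy)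

end Split

namespace Run

variable (r : Run G)

/-- All but at most four of the classes of edges on cycles are represented in a run. -/
lemma numDistinctCycleEdges_le_ncard_darts [Finite V] :
    numDistinctCycleEdges r.extGraph ≤ r.darts.ncard + 4 := by
  have : Finite r.extGraph.Dart := Finite.of_injective _ Dart.toProd_injective
  let cl : Sym2 r.extSide → Set (Sym2 r.extSide) := fun e => {f | Similar r.extGraph e f}
  let n₃ := r.newExt 2 (by simp)
  let n₄ := r.newExt 3 (by simp)
  -- A class without a chosen dart consists of edges at `n₃` or `n₄`, and these two vertices have at
  -- most two neighbours each.
  have hsub : cl '' cycleEdges r.extGraph ⊆ (fun d : r.extGraph.Dart => cl d.edge) '' r.darts ∪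
      ((fun w => cl s(n₃, w)) '' r.extGraph.neighborSet n₃ ∪
        (fun w => cl s(n₄, w)) '' r.extGraph.neighborSet n₄) := by
    rintro _ ⟨e, he, rfl⟩
    by_cases hcand : e ∈ r.candidateEdges
    · obtain ⟨d, ⟨hd, hsim⟩, -⟩ := r.existsUnique e hcand
      exact .inl ⟨d, hd, (setOf_similar_eq_iff.2 hsim).symm⟩
    · have hn : ∃ v ∈ e, v = n₃ ∨ v = n₄ := by
        by_contra! h
        exact hcand ⟨he, fun v hv => ⟨fun h' => (h v hv).1 (Subtype.ext h'),
          fun h' => (h v hv).2 (Subtype.ext h')⟩⟩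
      have hadj := cycleEdges_subset_edgeSet _ he
      obtain ⟨v, hv, hvn⟩ := hn
      obtain ⟨w, hw⟩ := hv
      rw [hw] at hadj ⊢
      rcases hvn with rfl | rfl
      · exact .inr (.inl ⟨w, hadj, rfl⟩)
      · exact .inr (.inr ⟨w, hadj, rfl⟩)
  have h₃ : (r.extGraph.neighborSet n₃).ncard ≤ 2 := Split.ncard_neighborSet_newExt 2 (by simp)
  have h₄ : (r.extGraph.neighborSet n₄).ncard ≤ 2 := Split.ncard_neighborSet_newExt 3 (by simp)
  calc numDistinctCycleEdges r.extGraph ≤ _ := Set.ncard_le_ncard hsub (Set.toFinite _)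
    _ ≤ _ := Set.ncard_union_le _ _
    _ ≤ r.darts.ncard + (2 + 2) := Nat.add_le_add (Set.ncard_image_le (Set.toFinite _))
      ((Set.ncard_union_le _ _).trans (Nat.add_le_add
        ((Set.ncard_image_le (Set.toFinite _)).trans h₃)
        ((Set.ncard_image_le (Set.toFinite _)).trans h₄)))

end Run

end Construction

/-! ### Selecting inequivalent representatives by Hall's theorem. -/

section Selection

/-- If the classes of an equivalence relation on a disjoint union have at most `C` elements, one
can select `M` elements of each of the sets so that all of them are pairwise inequivalent, provided
that each set has at least `M * C` elements. -/
lemma exists_selection {ι : Type*} {X : ι → Type*} [∀ i, Finite (X i)] (r : Setoid (Σ i, X i))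
    {M C : ℕ} (hpos : 0 < C)
    (hC : ∀ p, {q | r q p}.Finite ∧ {q | r q p}.ncard ≤ C)
    (hX : ∀ i, M * C ≤ Nat.card (X i)) :
    ∃ A : (i : ι) → Finset (X i), (∀ i, (A i).card = M) ∧
      ∀ p q : Σ i, X i, p.2 ∈ A p.1 → q.2 ∈ A q.1 → r p q → p = q := by
  classical
  have := fun i => Fintype.ofFinite (X i)
  -- Each `i` makes `M` requests for a class meeting `X i`; a system of distinct representatives
  -- gives the selection.
  let t : ι × Fin M → Finset (Quotient r) := fun i =>
    Finset.univ.image fun x : X i.1 => (⟦⟨i.1, x⟩⟧ : Quotient r)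
  have hall : ∀ s : Finset (ι × Fin M), s.card ≤ (s.biUnion t).card := by
    intro s
    let I := s.image Prod.fst
    let P : Finset (Σ i, X i) := I.sigma fun _ => Finset.univ
    have h₁ : s.card ≤ I.card * M := by
      calc s.card ≤ (I ×ˢ (Finset.univ : Finset (Fin M))).card :=
            Finset.card_le_card fun p hp => by
              simpa [I] using ⟨p.2, hp⟩
        _ = I.card * M := by simp
    have h₂ : I.card * (M * C) ≤ P.card := by
      rw [Finset.card_sigma, ← smul_eq_mul]
      refine Finset.card_nsmul_le_sum _ _ _ fun i _ => ?_
      rw [Finset.card_univ, ← Nat.card_eq_fintype_card]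
      exact hX i
    -- Each class absorbs at most `C` elements of `P`, which together with `h₂` gives Hall's
    -- condition.
    have h₃ : P.card ≤ C * (s.biUnion t).card := by
      refine Finset.card_le_mul_card_image_of_maps_to (f := fun p => (⟦p⟧ : Quotient r)) ?_ _ ?_
      · rintro ⟨i, x⟩ hp
        simp only [P, I, Finset.mem_sigma, Finset.mem_image] at hp
        obtain ⟨⟨p, hp, rfl⟩, -⟩ := hp
        exact Finset.mem_biUnion.2 ⟨p, hp, Finset.mem_image_of_mem _ (Finset.mem_univ _)⟩
      · intro b _
        obtain ⟨p, rfl⟩ := Quotient.exists_rep b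
        obtain ⟨hf, hle⟩ := hC p
        rw [← Set.ncard_coe_finset]
        refine (Set.ncard_le_ncard (fun q hq => ?_) hf).trans hle
        exact Quotient.exact (Finset.mem_filter.1 hq).2
    have h₄ : I.card * M * C ≤ (s.biUnion t).card * C := by
      rw [mul_assoc, mul_comm (s.biUnion t).card]
      exact h₂.trans h₃
    exact h₁.trans (Nat.le_of_mul_le_mul_right h₄ hpos)
  obtain ⟨f, hf, hft⟩ := (Finset.all_card_le_biUnion_card_iff_exists_injective t).1 hall
  have hg : ∀ i k, ∃ x : X i, (⟦⟨i, x⟩⟧ : Quotient r) = f (i, k) := fun i k => by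
    simpa [t] using hft (i, k)
  choose g hg using hg
  have hinj : ∀ i k j l, r ⟨i, g i k⟩ ⟨j, g j l⟩ → (i, k) = (j, l) := fun i k j l h =>
    hf (by rw [← hg, ← hg]; exact Quotient.sound h)
  refine ⟨fun i => Finset.univ.image (g i), fun i => ?_, ?_⟩
  · rw [Finset.card_image_of_injective, Finset.card_univ, Fintype.card_fin]
    intro k l hkl
    have := hinj i k i l (by rw [hkl])
    simpa using this
  · rintro ⟨i, x⟩ ⟨j, y⟩ hx hy hxy
    simp only [Finset.mem_image, Finset.mem_univ, true_and] at hx hy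
    obtain ⟨k, rfl⟩ := hx
    obtain ⟨l, rfl⟩ := hy
    obtain ⟨rfl, rfl⟩ := Prod.ext_iff.1 (hinj i k j l hxy)
    rfl

end Selection

/-! ### Bounding the isomorphism classes of outputs. -/

section Counting

/-- A bound for the number of ways to place the labels in an output. -/
def labelBound : ℕ := 256 ^ 10

lemma labelBound_pos : 0 < labelBound := Nat.pow_pos (by simp)

/-- Isomorphism of outputs, as an equivalence relation on all outputs of a family of runs. -/
def outputSetoid {V ι : Type*} {G : ι → SimpleGraph V} (r : (i : ι) → Run (G i)) :
    Setoid (Σ i, (r i).darts) where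
  r p q := Nonempty ((r p.1).output p.2 ≃g (r q.1).output q.2)
  iseqv := ⟨fun _ => ⟨Iso.refl⟩, fun ⟨φ⟩ => ⟨φ.symm⟩, fun ⟨φ⟩ ⟨ψ⟩ => ⟨φ.trans ψ⟩⟩

/-- Only boundedly many outputs of pairwise non-isomorphic graphs are isomorphic to a given one. -/
lemma ncard_setOf_output_iso_le {V ι : Type*} [Finite V] {G : ι → SimpleGraph V}
    (hc : ∀ i, (G i).Connected) (hb : ∀ i, ¬ HasBridge (G i)) (h3 : ∀ i, IsCubic (G i))
    (hG : ∀ i j, i ≠ j → IsEmpty (G i ≃g G j)) (r : (i : ι) → Run (G i))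
    (p : Σ i, (r i).darts) :
    {q | outputSetoid r q p}.Finite ∧ {q | outputSetoid r q p}.ncard ≤ labelBound := by
  have hout := fun q : Σ i, (r i).darts =>
    (r q.1).toSplit.isOutput (hb q.1) (h3 q.1) ((r q.1).admissible q.2 q.2.2)
  choose x y hx hy hout using hout
  let lab : (q : Σ i, (r i).darts) → Fin 10 → V ⊕ Fin 4 := fun q =>
    IsOutput.labels (r q.1).a₁ (r q.1).b₁ (r q.1).a₂ (r q.1).b₂ (x q).1 (y q).1
  let B := setBall ((r p.1).output p.2) (Set.range Sum.inr) 3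
  let K := {q | outputSetoid r q p}
  let φ : ∀ q : K, (r q.1.1).output q.1.2 ≃g (r p.1).output p.2 := fun q => q.2.some
  -- Records where a chosen isomorphism to the output `p` puts the ten labels.
  let L : K → Fin 10 → B := fun q k =>
    ⟨φ q (lab q k), (hout q).apply_labels_mem (hout p) (hb p.1) (φ q) k⟩
  have hL : Function.Injective L := by
    intro q q' hqq
    obtain ⟨σ, ha₁, hb₁, ha₂, hb₂, hσx, hσy⟩ := (hout q.1).exists_iso (hout q'.1)
      ((φ q).trans (φ q').symm) fun k => by
        have : φ q (lab q k) = φ q' (lab q' k) := congrArg Subtype.val (congrFun hqq k)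
        change (φ q').symm (φ q (lab q k)) = lab q' k
        rw [this]
        simp
    obtain ⟨⟨i, d, hd⟩, hq⟩ := q
    obtain ⟨⟨j, d', hd'⟩, hq'⟩ := q'
    obtain rfl : i = j := by
      by_contra hij
      exact (hG i j hij).false σ
    obtain ⟨ψ, hψ⟩ := (r i).toSplit.exists_extGraph_iso (hc i) (hb i) σ ha₁ hb₁ ha₂ hb₂
    -- The automorphism of the common source fixes the cut, hence extends to `G₁'` and carries one
    -- inserted edge to the other; a run has one dart per class.
    have hsim : Similar (r i).extGraph d.edge d'.edge := by
      refine ⟨ψ, ?_⟩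
      change s(ψ d.fst, ψ d.snd) = s(d'.fst, d'.snd)
      have h₁ := hx ⟨i, d, hd⟩
      have h₂ := hy ⟨i, d, hd⟩
      have h₃ := hx ⟨i, d', hd'⟩
      have h₄ := hy ⟨i, d', hd'⟩
      simp only at h₁ h₂ h₃ h₄
      rw [h₁, h₂, h₃, h₄, hψ _ _ hσx, hψ _ _ hσy]
    obtain rfl : d = d' := ((r i).existsUnique d.edge ((r i).admissible d hd).mem).unique
      ⟨hd, similar_refl _⟩ ⟨hd', hsim⟩
    rfl
  have hfin : Finite K := Finite.of_injective L hL
  refine ⟨Set.toFinite K, ?_⟩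
  -- Radius three around the four new vertices: `4 * 4 ^ 3 = 256`.
  have hB : Nat.card B ≤ 256 := by
    refine (ncard_setBall_le (fun v => (((hout p).isCubic (h3 p.1)) v).le) _ _).trans ?_
    rw [← Set.image_univ, Set.ncard_image_of_injective _ Sum.inr_injective, Set.ncard_univ,
      Nat.card_fin]
    norm_num
  calc K.ncard = Nat.card K := (Nat.card_coe_set_eq K).symm
    _ ≤ Nat.card (Fin 10 → B) := Nat.card_le_card_of_injective L hL
    _ = Nat.card B ^ 10 := by rw [Nat.card_fun, Nat.card_fin]
    _ ≤ 256 ^ 10 := Nat.pow_le_pow_left hB 10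

end Counting

end BridgeConstruction

open BridgeConstruction in
theorem theorem4p3 :
    -- the construction can be carried out on every biconnected cubic graph
    (∀ (n : ℕ) (G : SimpleGraph (Fin n)), BridgeConstruction.IsBiconnected G →
      BridgeConstruction.IsCubic G → Nonempty (BridgeConstruction.Run G)) ∧
    -- whatever choices are made, it produces connected cubic bridge graphs on `n + 4` vertices
    (∀ (n : ℕ) (G : SimpleGraph (Fin n)), BridgeConstruction.IsBiconnected G →
      BridgeConstruction.IsCubic G → ∀ r : BridgeConstruction.Run G, ∀ d ∈ r.darts,
        (r.output d).Connected ∧ BridgeConstruction.IsCubic (r.output d) ∧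
          BridgeConstruction.HasBridge (r.output d) ∧ Nat.card (Fin n ⊕ Fin 4) = n + 4) ∧
    -- the number of pairwise distinct edges on cycles of `G₁'` grows without bound
    (∀ M : ℕ, ∃ N : ℕ, ∀ n ≥ N, ∀ G : SimpleGraph (Fin n), BridgeConstruction.IsBiconnected G →
      BridgeConstruction.IsCubic G → ∀ r : BridgeConstruction.Run G,
        M ≤ BridgeConstruction.numDistinctCycleEdges r.toSplit.extGraph) ∧
    -- for `n` large, whatever choices are made, `M` graphs can be kept for every source graph
    -- so that all the graphs kept are pairwise non-isomorphic
    (∀ M : ℕ, ∃ N : ℕ, ∀ n ≥ N, ∀ (ι : Type) (G : ι → SimpleGraph (Fin n)),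
      (∀ i, BridgeConstruction.IsBiconnected (G i)) →
      (∀ i, BridgeConstruction.IsCubic (G i)) →
      (∀ i j, i ≠ j → IsEmpty (G i ≃g G j)) →
      ∀ r : (i : ι) → BridgeConstruction.Run (G i),
        ∃ A : (i : ι) → Finset ((r i).toSplit.extGraph.Dart),
          (∀ i, ↑(A i) ⊆ (r i).darts ∧ (A i).card = M) ∧
          (∀ i, ∀ d ∈ A i, ∀ d' ∈ A i, d ≠ d' →
            IsEmpty ((r i).output d ≃g (r i).output d')) ∧
          (∀ i j, i ≠ j → ∀ d ∈ A i, ∀ d' ∈ A j,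
            IsEmpty ((r i).output d ≃g (r j).output d'))) := by
  refine ⟨fun n G hG h3 => ?_, fun n G hG h3 r d hd => ?_, fun M => ?_, fun M => ?_⟩
  · obtain ⟨s⟩ := exists_split hG
    exact s.exists_run hG.bridgeless h3
  · obtain ⟨x, y, -, -, h⟩ := r.toSplit.isOutput hG.bridgeless h3 (r.admissible d hd)
    exact ⟨h.connected hG.connected, h.isCubic h3, h.hasBridge, by simp⟩
  · exact ⟨Split.growthBound M, fun n hn G hG h3 r =>
      r.toSplit.le_numDistinctCycleEdges_extGraph hG.connected hG.bridgeless h3 (by simpa using hn)⟩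
  -- The summand 4 pays for the classes without a dart, the factor `labelBound` for outputs
  -- isomorphic to one another.
  · refine ⟨Split.growthBound (M * labelBound + 4), fun n hn ι G hG h3 hiso r => ?_⟩
    have : ∀ i, Finite (r i).extGraph.Dart := fun i =>
      Finite.of_injective _ SimpleGraph.Dart.toProd_injective
    obtain ⟨A, hA, hsel⟩ := exists_selection (outputSetoid r) (M := M) labelBound_pos
      (ncard_setOf_output_iso_le (fun i => (hG i).connected) (fun i => (hG i).bridgeless) h3 hiso r)
      fun i => by
        have h₁ := (r i).toSplit.le_numDistinctCycleEdges_extGraph (hG i).connected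
          (hG i).bridgeless (h3 i) (M := M * labelBound + 4) (by simpa using hn)
        have h₂ := (r i).numDistinctCycleEdges_le_ncard_darts
        rw [Nat.card_coe_set_eq]
        exact Nat.le_of_add_le_add_right (h₁.trans h₂)
    -- The transported equality treats outputs of one source and of different sources together.
    have hsel' : ∀ i j, ∀ d ∈ (A i).map (.subtype _), ∀ d' ∈ (A j).map (.subtype _),
        Nonempty ((r i).output d ≃g (r j).output d') →
          ∃ hij : i = j, hij ▸ d = d' := by
      intro i j d hd d' hd' h
      obtain ⟨⟨d, hdr⟩, hdA, rfl⟩ := Finset.mem_map.1 hd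
      obtain ⟨⟨d', hdr'⟩, hdA', rfl⟩ := Finset.mem_map.1 hd'
      cases hsel ⟨i, d, hdr⟩ ⟨j, d', hdr'⟩ hdA hdA' h
      exact ⟨rfl, rfl⟩
    refine ⟨fun i => (A i).map (.subtype _), fun i => ⟨?_, ?_⟩, ?_, ?_⟩
    · intro d hd
      obtain ⟨d, -, rfl⟩ := Finset.mem_map.1 hd
      exact d.2
    · rw [Finset.card_map, hA]
    · intro i d hd d' hd' hne
      rw [← not_nonempty_iff]
      exact fun h => hne (hsel' i i d hd d' hd' h).2
    · intro i j hij d hd d' hd'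
      rw [← not_nonempty_iff]
      exact fun h => hij (hsel' i j d hd d' hd' h).1
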